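/- Let $N\ge 2$ be an integer, $f:\mathbb R\to\mathbb R$ locally Lipschitz continuous, $I=(0,1)$, $T>0$, $Q_T=[0,1]\times[0,T]$ and $u^0\in C([0,1])$. Consider $$u_t=u_{xx}+\tfrac{N-1}{x}u_x+f(u)\quad (x\in I,\ 0<t\le T),\qquad u_x(0,t)=u(1,t)=0\quad(0<t\le T),\qquad u(x,0)=u^0(x)\quad (x\in I).\tag{1}$$ For a function $u$ on $Q_T$ such that the derivatives below exist and are continuous on $Q_T$ put $$\kappa(u)=\sum_{k=0}^{2}\|\partial_x^k u\|_{L^\infty(Q_T)}+\sum_{l=1}^{2}\|\partial_t^l u\|_{L^\infty(Q_T)}+\sum_{k=1}^{2}\|\partial_t\partial_x^k u\|_{L^\infty(Q_T)} .$$ Write $(w,v)=\int_I x^{N-1}wv\,dx$, $\|v\|=(v,v)^{1/2}$ and $A(w,v)=\int_I x^{N-1}w_xv_x\,dx$. For a partition $0=x_0<x_1<\dots<x_m=1$ let $h_j=x_j-x_{j-1}$ and $h=\max_{1\le j\le m} h_j$; let $S_h$ be the space of continuous functions on $[0,1]$ that are affine on each $(x_{j-1},x_j)$ and vanish at $x=1$;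 let $\phi_i\in S_h$ ($0\le i\le m-1$) be the function with $\phi_i(x_j)=\delta_{ij}$; and let $\langle w,v\rangle=\sum_{i=0}^{m-1}w(x_i)v(x_i)\,(1,\phi_i)$. Let $\tau_j>0$ ($j\ge 0$) be time increments with $\tau=\sup_{j\ge0}\tau_j<\infty$, and let $t_n=\sum_{j=0}^{n-1}\tau_j$. Given $u_h^0\in S_h$, the scheme (ML--1) seeks $u_h^{n+1}\in S_h$, $n=0,1,\dots$, such that $$\Big\langle \frac{u_h^{n+1}-u_h^n}{\tau_n},\chi\Big\rangle+A(u_h^{n+1},\chi)=(f(u_h^n),\chi)\qquad\text{for all }\chi\in S_h .$$ **Theorem (optimal $L^2$ error estimate for (ML--1)).** Let $T,C_0,\beta>0$ and $K\in\mathbb R$. There are positive constants $C$, $h_0$ and $\tau_0$, depending only on $T,f,K,C_0,N,\beta$, with the following property. Let $u$ be a solution of (1) on $[0,T]$ for which all the derivatives occurring in $\kappa(u)$ exist and are continuous on $Q_T$, with $\kappa(u)\le K$. Let the partition satisfy $h\le\beta\min_{1\le j\le m}h_j$, let $h\le h_0$ and $\tau\le\tau_0$, and let $\|u_h^0-u^0\|_{L^\infty(I)}\le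 C_0h^2$. Then the solution $u_h^n$ of (ML--1) satisfies $$\sup_{0\le t_n\le T}\|u_h^n-u(\cdot,t_n)\|\le C(h^2+\tau).$$ -/

import Mathlib

namespace RadialHeat

/-! ### Maximum norms and partial derivatives on the space-time cylinder -/

/-- `max_{p ∈ s} |v p|`; used for functions continuous on a nonempty compact set `s`. -/
noncomputable def maxNorm {α : Type*} (s : Set α) (v : α → ℝ) : ℝ :=
  sSup ((fun p => |v p|) '' s)

/-- The closed cylinder `Q_T = [0,1] × [0,T]`, with points `(x, t)`. -/
def cylinder (T : ℝ) : Set (ℝ × ℝ) := Set.Icc 0 1 ×ˢ Set.Icc 0 T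

/-- `∂v/∂x` on `Q_T` (one-sided at `x = 0` and `x = 1`), for `v = v(x, t)`. -/
noncomputable def dx (v : ℝ × ℝ → ℝ) : ℝ × ℝ → ℝ :=
  fun p => derivWithin (fun y => v (y, p.2)) (Set.Icc 0 1) p.1

/-- `∂v/∂t` on `Q_T` (one-sided at `t = 0` and `t = T`), for `v = v(x, t)`. -/
noncomputable def dt (T : ℝ) (v : ℝ × ℝ → ℝ) : ℝ × ℝ → ℝ :=
  fun p => derivWithin (fun s => v (p.1, s)) (Set.Icc 0 T) p.2

/-- `∂v/∂x` exists at every point of `Q_T` and is continuous on `Q_T`. -/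
def HasContDx (T : ℝ) (v : ℝ × ℝ → ℝ) : Prop :=
  (∀ t ∈ Set.Icc 0 T, DifferentiableOn ℝ (fun y => v (y, t)) (Set.Icc 0 1)) ∧
    ContinuousOn (dx v) (cylinder T)

/-- `∂v/∂t` exists at every point of `Q_T` and is continuous on `Q_T`. -/
def HasContDt (T : ℝ) (v : ℝ × ℝ → ℝ) : Prop :=
  (∀ x ∈ Set.Icc (0 : ℝ) 1, DifferentiableOn ℝ (fun s => v (x, s)) (Set.Icc 0 T)) ∧
    ContinuousOn (dt T v) (cylinder T)

/-- All the derivatives that occur in `κ(u)` exist and are continuous on `Q_T`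
(so that each of the norms in `κ(u)` is a finite maximum). -/
structure IsSmooth (T : ℝ) (u : ℝ × ℝ → ℝ) : Prop where
  cont : ContinuousOn u (cylinder T)
  u_x : HasContDx T u
  u_xx : HasContDx T (dx u)
  u_t : HasContDt T u
  u_tt : HasContDt T (dt T u)
  u_tx : HasContDt T (dx u)
  u_txx : HasContDt T (dx (dx u))

/-- `κ(u)`: the sum of the maximum norms over `Q_T` of
`u, u_x, u_xx, u_t, u_tt, u_tx, u_txx`. -/
noncomputable def kappa (T : ℝ) (u : ℝ × ℝ → ℝ) : ℝ :=
  (maxNorm (cylinder T) u + maxNorm (cylinder T) (dx u) + maxNorm (cylinder T) (dx (dx u)))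
    + (maxNorm (cylinder T) (dt T u) + maxNorm (cylinder T) (dt T (dt T u)))
    + (maxNorm (cylinder T) (dt T (dx u)) + maxNorm (cylinder T) (dt T (dx (dx u))))

/-- `u` is a classical solution on `[0,T]` of
`u_t = u_xx + ((N-1)/x) u_x + f(u)` in `(0,1)`, `u_x(0,t) = u(1,t) = 0`, `u(x,0) = u⁰(x)`. -/
structure IsSolution (N : ℕ) (f : ℝ → ℝ) (u0 : ℝ → ℝ) (T : ℝ) (u : ℝ × ℝ → ℝ) : Prop where
  pde : ∀ x ∈ Set.Ioo (0 : ℝ) 1, ∀ t ∈ Set.Ioc 0 T,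
    dt T u (x, t) = dx (dx u) (x, t) + ((N : ℝ) - 1) / x * dx u (x, t) + f (u (x, t))
  neumann : ∀ t ∈ Set.Ioc 0 T, dx u (0, t) = 0
  dirichlet : ∀ t ∈ Set.Ioc 0 T, u (1, t) = 0
  initial : ∀ x ∈ Set.Ioo (0 : ℝ) 1, u (x, 0) = u0 x

/-! ### Weighted forms -/

/-- `(w, v) = ∫_I x^{N-1} w v dx`, `I = (0,1)`. -/
noncomputable def ip (N : ℕ) (w v : ℝ → ℝ) : ℝ :=
  ∫ x in (0 : ℝ)..1, x ^ (N - 1) * (w x * v x)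

/-- The weighted `L²` norm `‖v‖ = (v, v)^{1/2}`. -/
noncomputable def wnorm (N : ℕ) (v : ℝ → ℝ) : ℝ := Real.sqrt (ip N v v)

/-- `A(w, v) = ∫_I x^{N-1} w_x v_x dx`. It is applied to continuous piecewise affine functions only,
whose weak derivative is the classical one off the finitely many nodes. -/
noncomputable def formA (N : ℕ) (w v : ℝ → ℝ) : ℝ :=
  ∫ x in (0 : ℝ)..1, x ^ (N - 1) * (deriv w x * deriv v x)

/-! ### Meshes and the finite element space -/

/-- A partition `0 = x_0 < x_1 < ⋯ < x_m = 1`. Only `x j` with `j ≤ m` matter. -/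
structure Mesh where
  m : ℕ
  x : ℕ → ℝ
  x_zero : x 0 = 0
  x_last : x m = 1
  x_lt : ∀ j < m, x j < x (j + 1)

namespace Mesh

/-- The length of the element `(x_j, x_{j+1})`, `j = 0, …, m-1`. -/
def step (M : Mesh) (j : ℕ) : ℝ := M.x (j + 1) - M.x j

/-- The granularity `h`, the largest of the `m` element lengths. -/
noncomputable def h (M : Mesh) : ℝ := ⨆ j : Fin M.m, M.step j

/-- Quasi-uniformity with constant `β`: `h ≤ β · min_j h_j`. -/
def QuasiUniform (M : Mesh) (β : ℝ) : Prop := M.h ≤ β * ⨅ j : Fin M.m, M.step j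

/-- Membership in the `P₁` finite element space `S_h`. A function that is affine on every
element belongs to `H¹(I)` iff its representative is continuous on `[0,1]`. Functions are
considered on `[0,1]`; the values elsewhere play no role. -/
structure MemS (M : Mesh) (v : ℝ → ℝ) : Prop where
  cont : ContinuousOn v (Set.Icc 0 1)
  affine : ∀ j < M.m, ∃ a b : ℝ, ∀ y ∈ Set.Ioo (M.x j) (M.x (j + 1)), v y = a * y + b
  right : v 1 = 0

/-- The hat function `φ_i`, `0 ≤ i < m`. For `i = 0` the first case is empty. -/
noncomputable def hat (M : Mesh) (i : ℕ) (y : ℝ) : ℝ :=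
  if M.x (i - 1) ≤ y ∧ y < M.x i then (y - M.x (i - 1)) / (M.x i - M.x (i - 1))
  else if M.x i ≤ y ∧ y ≤ M.x (i + 1) then (M.x (i + 1) - y) / (M.x (i + 1) - M.x i)
  else 0

/-- The mass-lumped product `⟨w, v⟩ = ∑_{i=0}^{m-1} w(x_i) v(x_i) (1, φ_i)`. -/
noncomputable def lump (M : Mesh) (N : ℕ) (w v : ℝ → ℝ) : ℝ :=
  ∑ i ∈ Finset.range M.m, w (M.x i) * v (M.x i) * ip N (fun _ => 1) (M.hat i)

end Mesh

/-- `t_n = τ_0 + ⋯ + τ_{n-1}`. -/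
def time (τ : ℕ → ℝ) (n : ℕ) : ℝ := ∑ j ∈ Finset.range n, τ j

/-- `U n = u_h^n` solves the scheme (ML-1) with time increments `τ n`: all `u_h^n` lie in `S_h` and
`⟨(u_h^{n+1} - u_h^n)/τ_n, χ⟩ + A(u_h^{n+1}, χ) = (f(u_h^n), χ)` for all `χ ∈ S_h`, `n ≥ 0`. -/
structure IsML1 (N : ℕ) (f : ℝ → ℝ) (M : Mesh) (τ : ℕ → ℝ) (U : ℕ → ℝ → ℝ) : Prop where
  mem : ∀ n, M.MemS (U n)
  scheme : ∀ n, ∀ χ, M.MemS χ →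
    M.lump N (fun y => (U (n + 1) y - U n y) / τ n) χ + formA N (U (n + 1)) χ
      = ip N (fun y => f (U n y)) χ

end RadialHeat

/-!
The error `u_h^n - u(·, t_n)` is split through the elliptic projection `P`, which for functions of
one variable can be written down: on each element the slope of `P w` is the mean value of `w'` with
respect to the weight `x^{N-1}`. Taylor's formula gives `√(x^{N-1}) |P w - w| ≤ (2N + 1) K h²` when
`w'` is `K`-Lipschitz and `w` vanishes at `1`; near the axis the factor `√(x^{N-1})` pays for the
`1 / x` in the difference of a weighted and an unweighted mean.

The remaining part `θ^n = u_h^n - P u(·, t_n)` satisfies one step of the scheme with a small right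
hand side. The lumped scheme obeys a discrete maximum principle, so `θ^n` is of order `h + τ` in the
maximum norm. Hence `u_h^n` stays in a fixed compact interval, where `f` is Lipschitz continuous,
and an energy estimate in the lumped norm followed by Gronwall's inequality gives `h² + τ`.
-/

open Set MeasureTheory intervalIntegral
open scoped NNReal

namespace RadialHeat

namespace Mesh

/-! ### Geometry of the mesh -/

section Geometry

variable (M : Mesh)

lemma m_pos : 0 < M.m := by
  by_contra! h
  have h_last := M.x_last
  rw [Nat.le_zero.1 h, M.x_zero] at h_last
  exact zero_ne_one h_last

lemma x_mono {i j : ℕ} (hij : i ≤ j) (hj : j ≤ M.m) : M.x i ≤ M.x j := by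
  induction j, hij using Nat.le_induction with
  | base => exact le_rfl
  | succ k _ ih => exact (ih (by omega)).trans (M.x_lt k (by omega)).le

lemma x_nonneg {j : ℕ} (hj : j ≤ M.m) : 0 ≤ M.x j :=
  M.x_zero.symm.trans_le (M.x_mono (Nat.zero_le j) hj)

lemma x_le_one {j : ℕ} (hj : j ≤ M.m) : M.x j ≤ 1 :=
  (M.x_mono hj le_rfl).trans_eq M.x_last

lemma x_mem_Icc {j : ℕ} (hj : j ≤ M.m) : M.x j ∈ Icc (0 : ℝ) 1 := ⟨M.x_nonneg hj, M.x_le_one hj⟩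

lemma elem_subset {j : ℕ} (hj : j < M.m) : Icc (M.x j) (M.x (j + 1)) ⊆ Icc 0 1 :=
  Icc_subset_Icc (M.x_nonneg hj.le) (M.x_le_one hj)

lemma step_pos {j : ℕ} (hj : j < M.m) : 0 < M.step j := sub_pos.2 (M.x_lt j hj)

lemma step_le_h {j : ℕ} (hj : j < M.m) : M.step j ≤ M.h :=
  le_ciSup (f := fun j : Fin M.m => M.step j) (Set.finite_range _).bddAbove ⟨j, hj⟩

lemma h_pos : 0 < M.h := (M.step_pos M.m_pos).trans_le (M.step_le_h M.m_pos)

lemma abs_sub_le_h {j : ℕ} (hj : j < M.m) {y z : ℝ} (hy : y ∈ Icc (M.x j) (M.x (j + 1)))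
    (hz : z ∈ Icc (M.x j) (M.x (j + 1))) : |y - z| ≤ M.h :=
  (abs_sub_le_of_le_of_le hy.1 hy.2 hz.1 hz.2).trans (M.step_le_h hj)

lemma exists_mem_elem {y : ℝ} (hy : y ∈ Icc (0 : ℝ) 1) :
    ∃ j < M.m, y ∈ Icc (M.x j) (M.x (j + 1)) := by
  by_contra! h
  have x_le : ∀ k ≤ M.m, M.x k ≤ y := by
    intro k hk
    induction k with
    | zero => exact M.x_zero.trans_le hy.1
    | succ k ih => exact le_of_not_ge fun hle => h k hk ⟨ih (by omega), hle⟩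
  have hm := M.m_pos
  refine h (M.m - 1) (by omega) ⟨x_le _ (by omega), ?_⟩
  rw [Nat.sub_add_cancel hm, M.x_last]
  exact hy.2

lemma integral_eq_sum {F : ℝ → ℝ}
    (hF : ∀ j < M.m, IntervalIntegrable F volume (M.x j) (M.x (j + 1))) :
    ∫ y in (0 : ℝ)..1, F y = ∑ j ∈ Finset.range M.m, ∫ y in (M.x j)..(M.x (j + 1)), F y := by
  rw [sum_integral_adjacent_intervals fun k hk => hF k hk, M.x_zero, M.x_last]

lemma intervalIntegrable_elem {F : ℝ → ℝ} (hF : ContinuousOn F (Icc 0 1)) {j : ℕ} (hj : j < M.m) :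
    IntervalIntegrable F volume (M.x j) (M.x (j + 1)) :=
  (hF.mono (M.elem_subset hj)).intervalIntegrable_of_Icc (M.x_lt j hj).le

end Geometry

/-! ### Piecewise affine functions -/

section PiecewiseAffine

variable {M : Mesh}

variable (M) in
/-- The slope of the piecewise affine interpolant of `v` on the element `(x_j, x_{j+1})`. -/
noncomputable def slope (v : ℝ → ℝ) (j : ℕ) : ℝ := (v (M.x (j + 1)) - v (M.x j)) / M.step j

lemma slope_mul_step (v : ℝ → ℝ) {j : ℕ} (hj : j < M.m) :
    M.slope v j * M.step j = v (M.x (j + 1)) - v (M.x j) :=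
  div_mul_cancel₀ _ (M.step_pos hj).ne'

lemma slope_sub (v w : ℝ → ℝ) (j : ℕ) :
    M.slope (fun y => v y - w y) j = M.slope v j - M.slope w j := by
  simp only [slope]
  ring

lemma memS_of_affine {v : ℝ → ℝ}
    (h : ∀ j < M.m, ∃ a b : ℝ, ∀ y ∈ Icc (M.x j) (M.x (j + 1)), v y = a * y + b)
    (h1 : v 1 = 0) : M.MemS v := by
  refine ⟨?_, fun j hj => (h j hj).imp fun a => Exists.imp fun b hab y hy =>
    hab y (Ioo_subset_Icc_self hy), h1⟩
  have cont_upto : ∀ k ≤ M.m, ContinuousOn v (Icc 0 (M.x k)) := by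
    intro k hk
    induction k with
    | zero => rw [M.x_zero, Icc_self]; exact continuousOn_singleton _ _
    | succ k ih =>
      rw [← Icc_union_Icc_eq_Icc (M.x_nonneg (Nat.le_of_succ_le hk)) (M.x_lt k hk).le]
      refine (ih (by omega)).union_of_isClosed ?_ isClosed_Icc isClosed_Icc
      obtain ⟨a, b, hab⟩ := h k hk
      exact ContinuousOn.congr (by fun_prop) hab
  simpa only [M.x_last] using cont_upto M.m le_rfl

lemma MemS.eq_on_elem {v : ℝ → ℝ} (hv : M.MemS v) {j : ℕ} (hj : j < M.m) {y : ℝ}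
    (hy : y ∈ Icc (M.x j) (M.x (j + 1))) :
    v y = v (M.x j) + M.slope v j * (y - M.x j) := by
  obtain ⟨a, b, hab⟩ := hv.affine j hj
  have hlt := M.x_lt j hj
  have affine_closed : EqOn v (fun y => a * y + b) (Icc (M.x j) (M.x (j + 1))) :=
    EqOn.of_subset_closure hab (hv.cont.mono (M.elem_subset hj)) (by fun_prop) Ioo_subset_Icc_self
      (closure_Ioo hlt.ne).ge
  have slope_eq : M.slope v j = a := by
    rw [slope, affine_closed (right_mem_Icc.2 hlt.le), affine_closed (left_mem_Icc.2 hlt.le),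
      div_eq_iff (M.step_pos hj).ne', step]
    ring
  rw [slope_eq, affine_closed hy, affine_closed (left_mem_Icc.2 hlt.le)]
  ring

lemma MemS.hasDerivAt {v : ℝ → ℝ} (hv : M.MemS v) {j : ℕ} (hj : j < M.m) {y : ℝ}
    (hy : y ∈ Ioo (M.x j) (M.x (j + 1))) : HasDerivAt v (M.slope v j) y := by
  have h_affine : v =ᶠ[nhds y] fun y => v (M.x j) + M.slope v j * (y - M.x j) := by
    filter_upwards [Ioo_mem_nhds hy.1 hy.2] with z hz
    exact hv.eq_on_elem hj (Ioo_subset_Icc_self hz)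
  refine HasDerivAt.congr_of_eventuallyEq ?_ h_affine
  simpa using (((hasDerivAt_id y).sub_const (M.x j)).const_mul (M.slope v j)).const_add (v (M.x j))

lemma MemS.sub {v w : ℝ → ℝ} (hv : M.MemS v) (hw : M.MemS w) : M.MemS (fun y => v y - w y) := by
  refine memS_of_affine (fun j hj => ⟨M.slope v j - M.slope w j,
    v (M.x j) - w (M.x j) - (M.slope v j - M.slope w j) * M.x j, fun y hy => ?_⟩)
    (by simp only [hv.right, hw.right, sub_self])
  simp only [hv.eq_on_elem hj hy, hw.eq_on_elem hj hy]
  ring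

lemma MemS.mem_segment {v : ℝ → ℝ} (hv : M.MemS v) {j : ℕ} (hj : j < M.m) {y : ℝ}
    (hy : y ∈ Icc (M.x j) (M.x (j + 1))) : v y ∈ segment ℝ (v (M.x j)) (v (M.x (j + 1))) := by
  have hs := M.step_pos hj
  refine ⟨(M.x (j + 1) - y) / M.step j, (y - M.x j) / M.step j,
    div_nonneg (sub_nonneg.2 hy.2) hs.le, div_nonneg (sub_nonneg.2 hy.1) hs.le, ?_, ?_⟩
  · rw [← add_div, div_eq_one_iff_eq hs.ne', step]
    ring
  · rw [hv.eq_on_elem hj hy, eq_add_of_sub_eq' (slope_mul_step v hj).symm, smul_eq_mul, smul_eq_mul]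
    field_simp
    rw [step]
    ring

lemma MemS.abs_le_of_nodal {v : ℝ → ℝ} (hv : M.MemS v) {B : ℝ} (hB : ∀ i ≤ M.m, |v (M.x i)| ≤ B)
    {y : ℝ} (hy : y ∈ Icc (0 : ℝ) 1) : |v y| ≤ B := by
  obtain ⟨j, hj, hyj⟩ := M.exists_mem_elem hy
  exact abs_le.2 ((convex_Icc (-B) B).segment_subset (abs_le.1 (hB j hj.le))
    (abs_le.1 (hB (j + 1) hj)) (hv.mem_segment hj hyj))

end PiecewiseAffine

/-! ### Hat functions and nodal interpolation -/

section Hat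

variable (M : Mesh)

lemma hat_eq_of_mem_right_elem {i : ℕ} {y : ℝ} (hy : y ∈ Icc (M.x i) (M.x (i + 1))) :
    M.hat i y = (M.x (i + 1) - y) / M.step i := by
  rw [hat, if_neg fun h => h.2.not_ge hy.1, if_pos (mem_Icc.1 hy), step]

lemma hat_succ_eq_of_mem_left_elem {i : ℕ} (hi : i + 1 < M.m) {y : ℝ}
    (hy : y ∈ Icc (M.x i) (M.x (i + 1))) : M.hat (i + 1) y = (y - M.x i) / M.step i := by
  rcases hy.2.lt_or_eq with h | rfl
  · rw [hat, Nat.add_sub_cancel, if_pos ⟨hy.1, h⟩, step]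
  · rw [M.hat_eq_of_mem_right_elem (left_mem_Icc.2 (M.x_lt _ hi).le), ← step,
      ← step, div_self (M.step_pos hi).ne', div_self (M.step_pos (i.lt_succ_self.trans hi)).ne']

lemma hat_eq_zero {i j : ℕ} (hi : i < M.m) (hj : j < M.m) (hij : i ≠ j) (hij' : i ≠ j + 1) {y : ℝ}
    (hy : y ∈ Icc (M.x j) (M.x (j + 1))) : M.hat i y = 0 := by
  rcases hij.lt_or_gt with h | h
  · have h_le := M.x_mono (show i + 1 ≤ j from h) hj.le
    have h_lt := M.x_lt i hi
    rw [hat, if_neg fun h' => by linarith [hy.1, h'.2]]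
    split_ifs with h'
    · rw [show y = M.x (i + 1) by linarith [hy.1, h'.2], sub_self, zero_div]
    · rfl
  · have h_le : M.x (j + 1) ≤ M.x (i - 1) := M.x_mono (by omega) (by omega)
    have h_lt : M.x (i - 1) < M.x i := by
      simpa only [Nat.sub_add_cancel (show 1 ≤ i by omega)] using M.x_lt (i - 1) (by omega)
    rw [hat]
    split_ifs with h' h''
    · rw [show y = M.x (i - 1) by linarith [hy.2, h'.1], sub_self, zero_div]
    · linarith [hy.2, h''.1]
    · rfl

lemma hat_on_elem {i j : ℕ} (hi : i < M.m) (hj : j < M.m) {y : ℝ}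
    (hy : y ∈ Icc (M.x j) (M.x (j + 1))) :
    M.hat i y = (if i = j then (M.x (j + 1) - y) / M.step j else 0)
      + (if i = j + 1 then (y - M.x j) / M.step j else 0) := by
  by_cases hij : i = j
  · subst hij
    rw [if_pos rfl, if_neg (by omega), M.hat_eq_of_mem_right_elem hy, add_zero]
  · by_cases hij' : i = j + 1
    · subst hij'
      rw [if_neg hij, if_pos rfl, M.hat_succ_eq_of_mem_left_elem hi hy, zero_add]
    · rw [if_neg hij, if_neg hij', M.hat_eq_zero hi hj hij hij' hy, add_zero]

lemma hat_one {i : ℕ} (hi : i < M.m) : M.hat i 1 = 0 := by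
  have hm : M.m - 1 + 1 = M.m := Nat.sub_add_cancel M.m_pos
  have h_mem : (1 : ℝ) ∈ Icc (M.x (M.m - 1)) (M.x (M.m - 1 + 1)) := by
    rw [hm, M.x_last]
    exact ⟨M.x_le_one (by omega), le_rfl⟩
  rw [M.hat_on_elem hi (by omega) h_mem, hm, M.x_last, if_neg hi.ne, sub_self, zero_div, ite_self,
    add_zero]

lemma hat_memS {i : ℕ} (hi : i < M.m) : M.MemS (M.hat i) := by
  refine memS_of_affine (fun j hj => ?_) (M.hat_one hi)
  by_cases hij : i = j
  · subst hij
    refine ⟨-1 / M.step i, M.x (i + 1) / M.step i, fun y hy => ?_⟩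
    rw [M.hat_eq_of_mem_right_elem hy]
    ring
  · by_cases hij' : i = j + 1
    · subst hij'
      refine ⟨1 / M.step j, -M.x j / M.step j, fun y hy => ?_⟩
      rw [M.hat_succ_eq_of_mem_left_elem hi hy]
      ring
    · exact ⟨0, 0, fun y hy => by rw [M.hat_eq_zero hi hj hij hij' hy, zero_mul, add_zero]⟩

lemma hat_node {i k : ℕ} (hi : i < M.m) (hk : k ≤ M.m) :
    M.hat i (M.x k) = if i = k then 1 else 0 := by
  rcases hk.lt_or_eq with h | rfl
  · rw [M.hat_on_elem hi h (left_mem_Icc.2 (M.x_lt k h).le), ← step, div_self (M.step_pos h).ne',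
      sub_self, zero_div, ite_self, add_zero]
  · rw [M.x_last, M.hat_one hi, if_neg hi.ne]

lemma hat_nonneg {i : ℕ} (hi : i < M.m) {y : ℝ} (hy : y ∈ Icc (0 : ℝ) 1) : 0 ≤ M.hat i y := by
  obtain ⟨j, hj, hyj⟩ := M.exists_mem_elem hy
  refine (convex_Ici (0 : ℝ)).segment_subset ?_ ?_ ((M.hat_memS hi).mem_segment hj hyj) <;>
  · rw [M.hat_node hi (by omega), mem_Ici]
    positivity

lemma abs_sub_node_le_h {i : ℕ} (hi : i < M.m) {y : ℝ} (hy : y ∈ Icc (0 : ℝ) 1)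
    (hne : M.hat i y ≠ 0) : |y - M.x i| ≤ M.h := by
  obtain ⟨j, hj, hyj⟩ := M.exists_mem_elem hy
  refine M.abs_sub_le_h hj hyj ?_
  by_cases hij : i = j
  · exact hij.symm ▸ left_mem_Icc.2 (M.x_lt j hj).le
  · by_cases hij' : i = j + 1
    · exact hij'.symm ▸ right_mem_Icc.2 (M.x_lt j hj).le
    · exact absurd (M.hat_eq_zero hi hj hij hij' hyj) hne

/-- The function of `S_h` with nodal values `c i`, `i < m`. The value `c m` is not used: functions
of `S_h` vanish at `x_m = 1`. -/
noncomputable def interp (c : ℕ → ℝ) (y : ℝ) : ℝ := ∑ i ∈ Finset.range M.m, c i * M.hat i y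

lemma interp_node {c : ℕ → ℝ} (hc : c M.m = 0) {k : ℕ} (hk : k ≤ M.m) :
    M.interp c (M.x k) = c k := by
  rw [interp, Finset.sum_congr rfl fun i hi => by rw [M.hat_node (Finset.mem_range.1 hi) hk]]
  simp only [mul_ite, mul_one, mul_zero, Finset.sum_ite_eq', Finset.mem_range]
  split_ifs with h
  · rfl
  · rw [show k = M.m by omega, hc]

lemma interp_memS (c : ℕ → ℝ) : M.MemS (M.interp c) := by
  refine memS_of_affine (fun j hj => ?_)
    (Finset.sum_eq_zero fun i hi => by rw [M.hat_one (Finset.mem_range.1 hi), mul_zero])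
  refine ⟨∑ i ∈ Finset.range M.m, c i * M.slope (M.hat i) j,
    ∑ i ∈ Finset.range M.m, c i * (M.hat i (M.x j) - M.slope (M.hat i) j * M.x j), fun y hy => ?_⟩
  rw [Finset.sum_mul, ← Finset.sum_add_distrib]
  refine Finset.sum_congr rfl fun i hi => ?_
  rw [(M.hat_memS (Finset.mem_range.1 hi)).eq_on_elem hj hy]
  ring

end Hat

end Mesh

/-! ### The weighted inner product -/

section InnerProduct

variable {N : ℕ} {v w χ : ℝ → ℝ}

lemma intervalIntegrable_ip (hv : ContinuousOn v (Icc 0 1)) (hw : ContinuousOn w (Icc 0 1)) :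
    IntervalIntegrable (fun x : ℝ => x ^ (N - 1) * (v x * w x)) volume 0 1 :=
  ContinuousOn.intervalIntegrable_of_Icc zero_le_one (by fun_prop)

lemma ip_nonneg (h : ∀ y ∈ Icc (0 : ℝ) 1, 0 ≤ v y * w y) : 0 ≤ ip N v w :=
  integral_nonneg zero_le_one fun y hy => mul_nonneg (pow_nonneg hy.1 _) (h y hy)

lemma ip_const_mul (c : ℝ) (v w : ℝ → ℝ) : ip N (fun y => c * v y) w = c * ip N v w := by
  simp only [ip]
  rw [← intervalIntegral.integral_const_mul]
  congr 1
  ext y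
  ring

lemma ip_sub (hv : ContinuousOn v (Icc 0 1)) (hw : ContinuousOn w (Icc 0 1))
    (hχ : ContinuousOn χ (Icc 0 1)) :
    ip N (fun y => v y - w y) χ = ip N v χ - ip N w χ := by
  simp only [ip]
  rw [← integral_sub (intervalIntegrable_ip hv hχ) (intervalIntegrable_ip hw hχ)]
  congr 1
  ext y
  ring

lemma two_mul_ip_le (hv : ContinuousOn v (Icc 0 1)) (hw : ContinuousOn w (Icc 0 1)) :
    2 * ip N v w ≤ ip N v v + ip N w w := by
  simp only [ip]
  rw [← intervalIntegral.integral_const_mul,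
    ← integral_add (intervalIntegrable_ip hv hv) (intervalIntegrable_ip hw hw)]
  refine integral_mono_on zero_le_one ((intervalIntegrable_ip hv hw).const_mul 2)
    ((intervalIntegrable_ip hv hv).add (intervalIntegrable_ip hw hw)) fun y hy => ?_
  nlinarith [mul_nonneg (pow_nonneg hy.1 (N - 1)) (sq_nonneg (v y - w y))]

lemma ip_self_le (hv : ContinuousOn v (Icc 0 1)) (hw : ContinuousOn w (Icc 0 1)) {a B : ℝ}
    (h : ∀ y ∈ Icc (0 : ℝ) 1, √(y ^ (N - 1)) * |v y| ≤ a * (√(y ^ (N - 1)) * |w y|) + B) :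
    ip N v v ≤ 2 * a ^ 2 * ip N w w + 2 * B ^ 2 := by
  have integrand_le : ∀ y ∈ Icc (0 : ℝ) 1, y ^ (N - 1) * (v y * v y)
      ≤ 2 * a ^ 2 * (y ^ (N - 1) * (w y * w y)) + 2 * B ^ 2 := by
    intro y hy
    have weighted_sq (z : ℝ → ℝ) : y ^ (N - 1) * (z y * z y) = (√(y ^ (N - 1)) * |z y|) ^ 2 := by
      rw [mul_pow, Real.sq_sqrt (pow_nonneg hy.1 _), sq_abs, sq (z y)]
    rw [weighted_sq, weighted_sq]
    calc (√(y ^ (N - 1)) * |v y|) ^ 2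
        ≤ (a * (√(y ^ (N - 1)) * |w y|) + B) ^ 2 :=
          pow_le_pow_left₀ (mul_nonneg (Real.sqrt_nonneg _) (abs_nonneg _)) (h y hy) 2
      _ ≤ 2 * ((a * (√(y ^ (N - 1)) * |w y|)) ^ 2 + B ^ 2) := add_sq_le
      _ = _ := by ring
  have integral_le := integral_mono_on zero_le_one (intervalIntegrable_ip hv hv)
    (((intervalIntegrable_ip (N := N) hw hw).const_mul (2 * a ^ 2)).add
      (intervalIntegrable_const (c := 2 * B ^ 2))) integrand_le
  rw [integral_add ((intervalIntegrable_ip hw hw).const_mul _) intervalIntegrable_const,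
    intervalIntegral.integral_const_mul] at integral_le
  simpa [ip] using integral_le

end InnerProduct

namespace Mesh

/-! ### The Dirichlet form and the lumped product on `S_h` -/

section Forms

variable {M : Mesh} (N : ℕ) {v χ : ℝ → ℝ}

variable (M) in
/-- The integral of the weight `x^{N-1}` over the element `(x_j, x_{j+1})`. -/
noncomputable def weight (j : ℕ) : ℝ := ∫ y in (M.x j)..(M.x (j + 1)), y ^ (N - 1)

lemma weight_pos {j : ℕ} (hj : j < M.m) : 0 < M.weight N j :=
  intervalIntegral_pos_of_pos_on ((continuous_pow _).intervalIntegrable _ _)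
    (fun _ hy => pow_pos ((M.x_nonneg hj.le).trans_lt hy.1) _) (M.x_lt j hj)

lemma sum_weight_le_one : ∑ j ∈ Finset.range M.m, M.weight N j ≤ 1 := by
  simp only [weight]
  rw [← M.integral_eq_sum fun j _ => (continuous_pow _).intervalIntegrable _ _, integral_pow,
    one_pow, zero_pow (Nat.succ_ne_zero _), sub_zero]
  exact div_le_one_of_le₀ (by linarith [(N - 1).cast_nonneg (α := ℝ)]) (by positivity)

lemma MemS.formA_eq (hv : M.MemS v) (hχ : M.MemS χ) :
    formA N v χ = ∑ j ∈ Finset.range M.m, M.slope v j * M.slope χ j * M.weight N j := by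
  have integrand_eq : ∀ j < M.m, EqOn (fun y : ℝ => y ^ (N - 1) * (M.slope v j * M.slope χ j))
      (fun y => y ^ (N - 1) * (deriv v y * deriv χ y)) (Ioo (M.x j) (M.x (j + 1))) := by
    intro j hj y hy
    simp only [(hv.hasDerivAt hj hy).deriv, (hχ.hasDerivAt hj hy).deriv]
  rw [formA, M.integral_eq_sum fun j hj => ?_]
  · refine Finset.sum_congr rfl fun j hj => ?_
    rw [Finset.mem_range] at hj
    rw [← integral_congr_Ioo_of_le (M.x_lt j hj).le (integrand_eq j hj),
      intervalIntegral.integral_mul_const, weight, mul_comm]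
  · have h_int : IntervalIntegrable (fun y : ℝ => y ^ (N - 1) * (M.slope v j * M.slope χ j)) volume
        (M.x j) (M.x (j + 1)) := Continuous.intervalIntegrable (by fun_prop) _ _
    refine h_int.congr_uIoo ?_
    rw [uIoo_of_le (M.x_lt j hj).le]
    exact integrand_eq j hj

lemma MemS.formA_sub {w : ℝ → ℝ} (hv : M.MemS v) (hw : M.MemS w) (hχ : M.MemS χ) :
    formA N (fun y => v y - w y) χ = formA N v χ - formA N w χ := by
  rw [(hv.sub hw).formA_eq N hχ, hv.formA_eq N hχ, hw.formA_eq N hχ, ← Finset.sum_sub_distrib]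
  refine Finset.sum_congr rfl fun j _ => ?_
  rw [slope_sub]
  ring

lemma MemS.formA_self_nonneg (hv : M.MemS v) : 0 ≤ formA N v v := by
  rw [hv.formA_eq N hv]
  exact Finset.sum_nonneg fun j hj =>
    mul_nonneg (mul_self_nonneg _) (weight_pos N (Finset.mem_range.1 hj)).le

/-- Discrete maximum principle. -/
lemma MemS.mul_formA_hat_nonneg (hv : M.MemS v) {i : ℕ} (hi : i < M.m)
    (hmax : ∀ k ≤ M.m, |v (M.x k)| ≤ |v (M.x i)|) : 0 ≤ v (M.x i) * formA N v (M.hat i) := by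
  have mul_le : ∀ k ≤ M.m, v (M.x i) * v (M.x k) ≤ v (M.x i) * v (M.x i) := fun k hk =>
    calc v (M.x i) * v (M.x k) ≤ |v (M.x i)| * |v (M.x k)| := by
          rw [← abs_mul]; exact le_abs_self _
      _ ≤ |v (M.x i)| * |v (M.x i)| := mul_le_mul_of_nonneg_left (hmax k hk) (abs_nonneg _)
      _ = v (M.x i) * v (M.x i) := abs_mul_abs_self _
  rw [hv.formA_eq N (M.hat_memS hi), Finset.mul_sum]
  refine Finset.sum_nonneg fun j hj => ?_
  rw [Finset.mem_range] at hj
  rw [← mul_assoc, ← mul_assoc]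
  refine mul_nonneg ?_ (weight_pos N hj).le
  simp only [slope, M.hat_node hi hj.le, M.hat_node hi (show j + 1 ≤ M.m from hj), mul_div_assoc']
  rw [div_mul_eq_mul_div, div_div]
  refine div_nonneg ?_ (mul_self_nonneg _)
  by_cases hij' : i = j + 1
  · subst hij'
    rw [if_pos rfl, if_neg (by omega)]
    linarith [mul_le j hj.le]
  · rw [if_neg hij']
    split_ifs with hij
    · subst hij
      linarith [mul_le (i + 1) hj]
    · simp

variable (M) in
/-- The nodal weight `(1, φ_i)`. -/
noncomputable def mass (i : ℕ) : ℝ := ip N (fun _ => 1) (M.hat i)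

lemma mass_pos {i : ℕ} (hi : i < M.m) : 0 < M.mass N i := by
  have h_lt := M.x_lt i hi
  have h_cont : ContinuousOn (fun y => y ^ (N - 1) * (1 * M.hat i y)) (Icc (0 : ℝ) 1) := by
    have := (M.hat_memS hi).cont
    fun_prop
  have right_elem_pos : 0 < ∫ y in (M.x i)..(M.x (i + 1)), y ^ (N - 1) * (1 * M.hat i y) := by
    refine intervalIntegral_pos_of_pos_on (M.intervalIntegrable_elem h_cont hi) (fun y hy => ?_)
      h_lt
    rw [M.hat_eq_of_mem_right_elem (Ioo_subset_Icc_self hy), one_mul]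
    exact mul_pos (pow_pos ((M.x_nonneg hi.le).trans_lt hy.1) _)
      (div_pos (sub_pos.2 hy.2) (M.step_pos hi))
  refine right_elem_pos.trans_le (integral_mono_interval (M.x_nonneg hi.le) h_lt.le (M.x_le_one hi)
    ((ae_restrict_iff' measurableSet_Ioc).2 (Filter.Eventually.of_forall fun y hy => ?_))
    (h_cont.intervalIntegrable_of_Icc zero_le_one))
  exact mul_nonneg (pow_nonneg hy.1.le _)
    (mul_nonneg zero_le_one (M.hat_nonneg hi (Ioc_subset_Icc_self hy)))

lemma abs_ip_hat_le {E : ℝ → ℝ} (hE : ContinuousOn E (Icc 0 1)) {i : ℕ} (hi : i < M.m) {B : ℝ}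
    (hB : ∀ y ∈ Icc (0 : ℝ) 1, M.hat i y ≠ 0 → |E y| ≤ B) :
    |ip N E (M.hat i)| ≤ B * M.mass N i := by
  have h_cont := (M.hat_memS hi).cont
  rw [mass, ← ip_const_mul]
  refine (intervalIntegral.abs_integral_le_integral_abs zero_le_one).trans
    (integral_mono_on zero_le_one (intervalIntegrable_ip hE h_cont).abs
      (intervalIntegrable_ip (by fun_prop) h_cont) fun y hy => ?_)
  rw [abs_mul, abs_mul, abs_of_nonneg (pow_nonneg hy.1 _), abs_of_nonneg (M.hat_nonneg hi hy)]
  refine mul_le_mul_of_nonneg_left ?_ (pow_nonneg hy.1 _)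
  rcases eq_or_ne (M.hat i y) 0 with h0 | h0
  · rw [h0, mul_zero, mul_zero]
  · rw [mul_one]
    exact mul_le_mul_of_nonneg_right (hB y hy h0) (M.hat_nonneg hi hy)

lemma lump_hat (v : ℝ → ℝ) {i : ℕ} (hi : i < M.m) :
    M.lump N v (M.hat i) = v (M.x i) * M.mass N i := by
  rw [lump, Finset.sum_eq_single_of_mem i (Finset.mem_range.2 hi) fun k hk hki => ?_]
  · rw [M.hat_node hi hi.le, if_pos rfl, mul_one, mass]
  · rw [M.hat_node hi (Finset.mem_range.1 hk).le, if_neg hki.symm, mul_zero, zero_mul]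

lemma MemS.exists_lump_eq_integral (v : ℝ → ℝ) (hχ : M.MemS χ) :
    ∃ w, M.MemS w ∧ (∀ k ≤ M.m, w (M.x k) = v (M.x k) * χ (M.x k)) ∧
      M.lump N v χ = ∫ y in (0 : ℝ)..1, y ^ (N - 1) * w y := by
  refine ⟨M.interp fun i => v (M.x i) * χ (M.x i), M.interp_memS _,
    fun k hk => M.interp_node (by rw [M.x_last, hχ.right, mul_zero]) hk, ?_⟩
  simp only [interp, Finset.mul_sum, lump]
  rw [intervalIntegral.integral_finsetSum fun i hi => ?_]
  · refine Finset.sum_congr rfl fun i _ => ?_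
    rw [ip, ← intervalIntegral.integral_const_mul]
    congr 1
    ext y
    ring
  · have := (M.hat_memS (Finset.mem_range.1 hi)).cont
    exact ContinuousOn.intervalIntegrable_of_Icc zero_le_one (by fun_prop)

lemma MemS.lump_self_le (hv : M.MemS v) {B : ℝ}
    (hB : ∀ j < M.m, ∀ y ∈ Icc (M.x j) (M.x (j + 1)),
      √(y ^ (N - 1)) * |v (M.x j)| ≤ B ∧ √(y ^ (N - 1)) * |v (M.x (j + 1))| ≤ B) :
    M.lump N v v ≤ B ^ 2 := by
  obtain ⟨w, hw, w_node, lump_eq⟩ := hv.exists_lump_eq_integral N v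
  have integrand_le : ∀ y ∈ Icc (0 : ℝ) 1, y ^ (N - 1) * w y ≤ B ^ 2 := by
    intro y hy
    obtain ⟨j, hj, hyj⟩ := M.exists_mem_elem hy
    have weighted_le : ∀ k ≤ M.m, √(y ^ (N - 1)) * |v (M.x k)| ≤ B →
        w (M.x k) ∈ {s : ℝ | y ^ (N - 1) * s ≤ B ^ 2} := fun k hk h_le => by
      rw [mem_ofPred_eq, w_node k hk, ← sq, ← sq_abs, ← Real.sq_sqrt (pow_nonneg hy.1 (N - 1)),
        ← mul_pow]
      exact pow_le_pow_left₀ (mul_nonneg (Real.sqrt_nonneg _) (abs_nonneg _)) h_le 2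
    have h_conv : Convex ℝ {s : ℝ | y ^ (N - 1) * s ≤ B ^ 2} :=
      (convex_Iic (B ^ 2)).is_linear_preimage (IsLinearMap.isLinearMap_smul (y ^ (N - 1)))
    exact h_conv.segment_subset (weighted_le j hj.le (hB j hj y hyj).1)
      (weighted_le (j + 1) hj (hB j hj y hyj).2) (hw.mem_segment hj hyj)
  have hw' := hw.cont
  have integral_le := integral_mono_on (μ := volume) zero_le_one
    (ContinuousOn.intervalIntegrable_of_Icc zero_le_one (by fun_prop))
    (intervalIntegrable_const (c := B ^ 2)) integrand_le
  rwa [intervalIntegral.integral_const, sub_zero, one_smul, ← lump_eq] at integral_le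

variable (M) in
/-- `∫ x^{N-1} (x - x_j) (x_{j+1} - x) dx` over the element `(x_j, x_{j+1})`, by which the lumped
product of two functions of `S_h` with slope `1` exceeds the exact one. -/
noncomputable def bubble (j : ℕ) : ℝ :=
  ∫ y in (M.x j)..(M.x (j + 1)), y ^ (N - 1) * ((y - M.x j) * (M.x (j + 1) - y))

lemma bubble_nonneg {j : ℕ} (hj : j < M.m) : 0 ≤ M.bubble N j :=
  integral_nonneg (M.x_lt j hj).le fun _ hy =>
    mul_nonneg (pow_nonneg ((M.x_nonneg hj.le).trans hy.1) _)
      (mul_nonneg (sub_nonneg.2 hy.1) (sub_nonneg.2 hy.2))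

lemma bubble_le {j : ℕ} (hj : j < M.m) : M.bubble N j ≤ M.h ^ 2 * M.weight N j := by
  rw [weight, bubble, ← intervalIntegral.integral_const_mul]
  refine integral_mono_on (M.x_lt j hj).le (Continuous.intervalIntegrable (by fun_prop) _ _)
    (Continuous.intervalIntegrable (by fun_prop) _ _) fun y hy => ?_
  have h_step := M.step_le_h hj
  rw [step] at h_step
  rw [mul_comm (M.h ^ 2), sq]
  refine mul_le_mul_of_nonneg_left ?_ (pow_nonneg ((M.x_nonneg hj.le).trans hy.1) _)
  exact mul_le_mul (by linarith [hy.2]) (by linarith [hy.1]) (sub_nonneg.2 hy.2) M.h_pos.le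

lemma MemS.lump_eq (hv : M.MemS v) (hχ : M.MemS χ) :
    M.lump N v χ = ip N v χ
      + ∑ j ∈ Finset.range M.m, M.slope v j * M.slope χ j * M.bubble N j := by
  obtain ⟨w, hw, w_node, lump_eq⟩ := hχ.exists_lump_eq_integral N v
  have hw' := hw.cont
  have hv' := hv.cont
  have hχ' := hχ.cont
  rw [lump_eq, ip,
    M.integral_eq_sum fun j hj => M.intervalIntegrable_elem (by fun_prop) hj,
    M.integral_eq_sum fun j hj => M.intervalIntegrable_elem (by fun_prop) hj,
    ← Finset.sum_add_distrib]
  refine Finset.sum_congr rfl fun j hj => ?_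
  rw [Finset.mem_range] at hj
  rw [bubble, ← intervalIntegral.integral_const_mul, ← integral_add
    (M.intervalIntegrable_elem (by fun_prop) hj) (Continuous.intervalIntegrable (by fun_prop) _ _)]
  refine integral_congr fun y hy => ?_
  rw [uIcc_of_le (M.x_lt j hj).le] at hy
  have w_slope : M.slope w j = M.slope v j * χ (M.x (j + 1)) + v (M.x j) * M.slope χ j := by
    simp only [slope, w_node j hj.le, w_node (j + 1) hj]
    ring
  have χ_right : χ (M.x (j + 1)) = χ (M.x j) + M.slope χ j * (M.x (j + 1) - M.x j) := by
    rw [← step, slope_mul_step χ hj]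
    ring
  simp only [hw.eq_on_elem hj hy, hv.eq_on_elem hj hy, hχ.eq_on_elem hj hy, w_slope,
    w_node j hj.le, χ_right]
  ring

lemma MemS.ip_self_le_lump (hv : M.MemS v) : ip N v v ≤ M.lump N v v := by
  rw [hv.lump_eq N hv]
  exact le_add_of_nonneg_right <| Finset.sum_nonneg fun j hj =>
    mul_nonneg (mul_self_nonneg _) (bubble_nonneg N (Finset.mem_range.1 hj))

lemma MemS.two_mul_ip_sub_lump_le (hv : M.MemS v) (hχ : M.MemS χ) {B : ℝ}
    (hB : ∀ j < M.m, |M.slope v j| ≤ B) :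
    2 * (ip N v χ - M.lump N v χ) ≤ B ^ 2 * M.h ^ 4 + formA N χ χ := by
  have elem_le : ∀ j < M.m, 2 * -(M.slope v j * M.slope χ j * M.bubble N j)
      ≤ B ^ 2 * M.h ^ 4 * M.weight N j + M.slope χ j * M.slope χ j * M.weight N j := by
    intro j hj
    have abs_le : |M.slope v j * M.slope χ j * M.bubble N j|
        ≤ B * |M.slope χ j| * (M.h ^ 2 * M.weight N j) := by
      rw [abs_mul, abs_mul, abs_of_nonneg (bubble_nonneg N hj)]
      exact mul_le_mul (mul_le_mul_of_nonneg_right (hB j hj) (abs_nonneg _)) (bubble_le N hj)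
        (bubble_nonneg N hj) (mul_nonneg ((abs_nonneg _).trans (hB j hj)) (abs_nonneg _))
    calc 2 * -(M.slope v j * M.slope χ j * M.bubble N j)
        ≤ 2 * (B * |M.slope χ j| * (M.h ^ 2 * M.weight N j)) := by
          linarith [neg_le_abs (M.slope v j * M.slope χ j * M.bubble N j)]
      _ = 2 * (B * M.h ^ 2) * |M.slope χ j| * M.weight N j := by ring
      _ ≤ ((B * M.h ^ 2) ^ 2 + |M.slope χ j| ^ 2) * M.weight N j :=
          mul_le_mul_of_nonneg_right (two_mul_le_add_sq _ _) (weight_pos N hj).le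
      _ = _ := by rw [sq_abs]; ring
  have sum_le := Finset.sum_le_sum fun j hj => elem_le j (Finset.mem_range.1 hj)
  rw [← Finset.mul_sum, Finset.sum_neg_distrib, Finset.sum_add_distrib, ← Finset.mul_sum,
    ← hχ.formA_eq N hχ] at sum_le
  have weight_le := mul_le_mul_of_nonneg_left (sum_weight_le_one (M := M) N)
    (show 0 ≤ B ^ 2 * M.h ^ 4 by positivity)
  rw [hv.lump_eq N hχ]
  linarith

end Forms

/-! ### One implicit step -/

section ImplicitStep

variable {M : Mesh} {N : ℕ} {τ : ℝ} {E W θ θ' : ℝ → ℝ}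

variable (M N) in
/-- `θ'` arises from `θ` by one step of size `τ` of the lumped implicit scheme with right hand side
`(E, χ) - ⟨W, χ⟩`. -/
def ImplicitStep (τ : ℝ) (E W θ θ' : ℝ → ℝ) : Prop :=
  ∀ χ, M.MemS χ → M.lump N (fun y => (θ' y - θ y) / τ) χ + formA N θ' χ = ip N E χ - M.lump N W χ

lemma ImplicitStep.abs_node_le (H : M.ImplicitStep N τ E W θ θ') (hτ : 0 < τ) (hθ' : M.MemS θ')
    (hE : ContinuousOn E (Icc 0 1)) {Θ B : ℝ} (hB : 0 ≤ B) (hΘ : ∀ i ≤ M.m, |θ (M.x i)| ≤ Θ)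
    (hEW : ∀ i < M.m, ∀ y ∈ Icc (0 : ℝ) 1, M.hat i y ≠ 0 → |E y - W (M.x i)| ≤ B) :
    ∀ k ≤ M.m, |θ' (M.x k)| ≤ Θ + τ * B := by
  have bound_nonneg : 0 ≤ Θ + τ * B :=
    add_nonneg ((abs_nonneg _).trans (hΘ 0 (Nat.zero_le _))) (mul_nonneg hτ.le hB)
  obtain ⟨i, hi, hmax⟩ := Finset.exists_max_image (Finset.range (M.m + 1))
    (fun k => |θ' (M.x k)|) ⟨0, by simp⟩
  simp only [Finset.mem_range, Nat.lt_succ_iff] at hi hmax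
  intro k hk
  refine (hmax k hk).trans ?_
  rcases hi.lt_or_eq with him | rfl
  · have residual_le :
        |(θ' (M.x i) - θ (M.x i)) / τ * M.mass N i + formA N θ' (M.hat i)| ≤ B * M.mass N i := by
      rw [← lump_hat N (fun y => (θ' y - θ y) / τ) him, H _ (M.hat_memS him), lump_hat N _ him,
        mass, ← ip_const_mul]
      simp only [mul_one]
      rw [← ip_sub hE continuousOn_const (M.hat_memS him).cont, ← mass]
      exact abs_ip_hat_le N (by fun_prop) him (hEW i him)
    have form_nonneg := hθ'.mul_formA_hat_nonneg N him hmax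
    have mul_mass_le : θ' (M.x i) * ((θ' (M.x i) - θ (M.x i)) / τ) * M.mass N i
        ≤ |θ' (M.x i)| * B * M.mass N i := by
      have := (le_abs_self _).trans ((abs_mul (θ' (M.x i)) _).trans_le
        (mul_le_mul_of_nonneg_left residual_le (abs_nonneg (θ' (M.x i)))))
      linarith
    have mul_sub_le := le_of_mul_le_mul_right mul_mass_le (mass_pos N him)
    rw [← mul_div_assoc, div_le_iff₀ hτ] at mul_sub_le
    have mul_le : θ' (M.x i) * θ (M.x i) ≤ |θ' (M.x i)| * Θ := (le_abs_self _).trans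
      ((abs_mul _ _).trans_le (mul_le_mul_of_nonneg_left (hΘ i hi) (abs_nonneg _)))
    by_contra! h_lt
    nlinarith [abs_mul_abs_self (θ' (M.x i)), bound_nonneg.trans_lt h_lt]
  · rwa [M.x_last, hθ'.right, abs_zero]

lemma lump_self_sub_le (hτ : 0 < τ) :
    M.lump N θ' θ' - M.lump N θ θ ≤ 2 * τ * M.lump N (fun y => (θ' y - θ y) / τ) θ' := by
  simp only [lump]
  rw [← Finset.sum_sub_distrib, Finset.mul_sum]
  refine Finset.sum_le_sum fun i hi => ?_
  rw [← sub_mul, ← mul_assoc]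
  refine mul_le_mul_of_nonneg_right ?_ (mass_pos N (Finset.mem_range.1 hi)).le
  have : 2 * τ * ((θ' (M.x i) - θ (M.x i)) / τ * θ' (M.x i))
      = 2 * (θ' (M.x i) - θ (M.x i)) * θ' (M.x i) := by field_simp
  nlinarith [sq_nonneg (θ' (M.x i) - θ (M.x i))]

lemma ImplicitStep.lump_self_le (H : M.ImplicitStep N τ E W θ θ') (hτ : 0 < τ) (hθ' : M.MemS θ')
    (hE : ContinuousOn E (Icc 0 1)) (hW : M.MemS W) {B : ℝ} (hB : ∀ j < M.m, |M.slope W j| ≤ B) :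
    (1 - τ) * M.lump N θ' θ' ≤ M.lump N θ θ
      + τ * (ip N (fun y => E y - W y) (fun y => E y - W y) + B ^ 2 * M.h ^ 4) := by
  have h_time := lump_self_sub_le (M := M) (N := N) (θ := θ) (θ' := θ') hτ
  have h_step := H θ' hθ'
  have h_lump := hW.two_mul_ip_sub_lump_le N hθ' hB
  have h_young := two_mul_ip_le (N := N) (hE.fun_sub hW.cont) hθ'.cont
  rw [ip_sub hE hW.cont hθ'.cont] at h_young
  have h_norm := hθ'.ip_self_le_lump N
  have h_form := hθ'.formA_self_nonneg N
  have h_rate : 2 * M.lump N (fun y => (θ' y - θ y) / τ) θ'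
      ≤ ip N (fun y => E y - W y) (fun y => E y - W y) + M.lump N θ' θ'
        + B ^ 2 * M.h ^ 4 := by linarith
  nlinarith [mul_le_mul_of_nonneg_left h_rate hτ.le]

end ImplicitStep

end Mesh

/-! ### The elliptic projection -/

lemma abs_le_sub_of_abs_le_succ {r φ : ℕ → ℝ} {k m : ℕ} (hm : r m = 0)
    (h : ∀ j, k ≤ j → j < m → |r j| ≤ |r (j + 1)| + (φ j - φ (j + 1))) {i : ℕ} (hki : k ≤ i)
    (him : i ≤ m) : |r i| ≤ φ i - φ m := by
  induction him using Nat.decreasingInduction with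
  | self => rw [hm, abs_zero, sub_self]
  | of_succ i hi ih => linarith [h i hki hi, ih (hki.trans i.le_succ)]

lemma sub_div_le_sqrt {a b : ℝ} (ha : 0 < a) (hab : a ≤ b) (hb : b ≤ 1) :
    (b - a) / b ≤ 2 / √a - 2 / √b := by
  obtain ⟨p, hp, rfl⟩ : ∃ p, 0 < p ∧ a = p ^ 2 :=
    ⟨√a, Real.sqrt_pos.2 ha, (Real.sq_sqrt ha.le).symm⟩
  obtain ⟨q, hq, rfl⟩ : ∃ q, 0 < q ∧ b = q ^ 2 :=
    ⟨√b, Real.sqrt_pos.2 (ha.trans_le hab), (Real.sq_sqrt (ha.trans_le hab).le).symm⟩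
  have hpq : p ≤ q := (sq_le_sq₀ hp.le hq.le).1 hab
  have hq1 : q ≤ 1 := (sq_le_one_iff₀ hq.le).1 hb
  rw [Real.sqrt_sq hp.le, Real.sqrt_sq hq.le, div_sub_div _ _ hp.ne' hq.ne',
    div_le_div_iff₀ (by positivity) (by positivity)]
  have h_sum : (p + q) * p ≤ 2 * q := by nlinarith
  nlinarith [mul_le_mul_of_nonneg_left h_sum (mul_nonneg hq.le (sub_nonneg.2 hpq))]

lemma one_sub_pow_le {s : ℝ} (hs : 0 ≤ s) (n : ℕ) : 1 - s ^ n ≤ n * (1 - s) := by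
  have bernoulli := one_add_mul_le_pow (a := s - 1) (by linarith) n
  rw [add_sub_cancel] at bernoulli
  linarith

namespace Mesh

section Projection

variable (M : Mesh) (N : ℕ)

/-- The mean of `g` over the element `(x_j, x_{j+1})` with respect to the weight `x^{N-1}`. -/
noncomputable def avg (g : ℝ → ℝ) (j : ℕ) : ℝ :=
  (∫ y in (M.x j)..(M.x (j + 1)), y ^ (N - 1) * g y) / M.weight N j

/-- The elliptic projection onto `S_h`, with respect to the form `A`, of the function which has
derivative `g` and vanishes at `1`. Its slope on each element is the weighted mean of `g`. -/
noncomputable def proj (g : ℝ → ℝ) : ℝ → ℝ :=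
  M.interp fun i => -∑ j ∈ Finset.Ico i M.m, M.step j * M.avg N g j

lemma proj_memS (g : ℝ → ℝ) : M.MemS (M.proj N g) := M.interp_memS _

lemma proj_node (g : ℝ → ℝ) {i : ℕ} (hi : i ≤ M.m) :
    M.proj N g (M.x i) = -∑ j ∈ Finset.Ico i M.m, M.step j * M.avg N g j :=
  M.interp_node (by rw [Finset.Ico_self, Finset.sum_empty, neg_zero]) hi

lemma slope_proj (g : ℝ → ℝ) {j : ℕ} (hj : j < M.m) : M.slope (M.proj N g) j = M.avg N g j := by
  rw [slope, M.proj_node N g hj.le, M.proj_node N g hj, Finset.sum_eq_sum_Ico_succ_bot hj,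
    div_eq_iff (M.step_pos hj).ne']
  ring

variable {M}

lemma weight_mul_avg_sub {g : ℝ → ℝ} (hg : ContinuousOn g (Icc 0 1)) {j : ℕ} (hj : j < M.m)
    (c : ℝ) : M.weight N j * (M.avg N g j - c)
      = ∫ y in (M.x j)..(M.x (j + 1)), y ^ (N - 1) * (g y - c) := by
  simp only [mul_sub]
  rw [integral_sub (M.intervalIntegrable_elem (by fun_prop) hj)
    (M.intervalIntegrable_elem (by fun_prop) hj), intervalIntegral.integral_mul_const, ← weight,
    avg, mul_div_cancel₀ _ (M.weight_pos N hj).ne']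

lemma integral_pow_mul_sub_avg {g : ℝ → ℝ} (hg : ContinuousOn g (Icc 0 1)) {j : ℕ}
    (hj : j < M.m) : ∫ z in (M.x j)..(M.x (j + 1)), z ^ (N - 1) * (g z - M.avg N g j) = 0 := by
  rw [← weight_mul_avg_sub N hg hj, sub_self, mul_zero]

/-- Away from the axis `1 - (z / b) ^ (N - 1)`, with `b = x_{j+1}`, is of order `h`: this is where
the second power of `h` in the error of the elliptic projection comes from. -/
lemma integral_sub_avg_eq {g : ℝ → ℝ} (hg : ContinuousOn g (Icc 0 1)) {j : ℕ} (hj : j < M.m)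
    (b : ℝ) : ∫ z in (M.x j)..(M.x (j + 1)), (g z - M.avg N g j)
      = ∫ z in (M.x j)..(M.x (j + 1)), (1 - (z / b) ^ (N - 1)) * (g z - M.avg N g j) := by
  have h_split (z : ℝ) : (1 - (z / b) ^ (N - 1)) * (g z - M.avg N g j)
      = (g z - M.avg N g j) - z ^ (N - 1) * (g z - M.avg N g j) / b ^ (N - 1) := by
    rw [div_pow]
    ring
  have h_int : IntervalIntegrable (fun z => g z - M.avg N g j) volume (M.x j) (M.x (j + 1)) :=
    M.intervalIntegrable_elem (by fun_prop) hj
  simp only [h_split]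
  rw [integral_sub h_int (M.intervalIntegrable_elem (by fun_prop) hj),
    intervalIntegral.integral_div, integral_pow_mul_sub_avg N hg hj, zero_div, sub_zero]

lemma avg_sub_div {g₁ g₂ : ℝ → ℝ} (h₁ : ContinuousOn g₁ (Icc 0 1)) (h₂ : ContinuousOn g₂ (Icc 0 1))
    (c : ℝ) {j : ℕ} (hj : j < M.m) :
    M.avg N (fun y => (g₁ y - g₂ y) / c) j = (M.avg N g₁ j - M.avg N g₂ j) / c := by
  simp only [avg, mul_div_assoc', mul_sub]
  rw [intervalIntegral.integral_div, integral_sub (M.intervalIntegrable_elem (by fun_prop) hj)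
    (M.intervalIntegrable_elem (by fun_prop) hj)]
  ring

lemma proj_sub_div {g₁ g₂ : ℝ → ℝ} (h₁ : ContinuousOn g₁ (Icc 0 1))
    (h₂ : ContinuousOn g₂ (Icc 0 1)) (c y : ℝ) :
    M.proj N (fun y => (g₁ y - g₂ y) / c) y = (M.proj N g₁ y - M.proj N g₂ y) / c := by
  have nodal_sum (i : ℕ) :
      ∑ j ∈ Finset.Ico i M.m, M.step j * M.avg N (fun y => (g₁ y - g₂ y) / c) j
      = (∑ j ∈ Finset.Ico i M.m, M.step j * M.avg N g₁ j
        - ∑ j ∈ Finset.Ico i M.m, M.step j * M.avg N g₂ j) / c := by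
    rw [← Finset.sum_sub_distrib, Finset.sum_div]
    refine Finset.sum_congr rfl fun j hj => ?_
    rw [avg_sub_div N h₁ h₂ c (Finset.mem_Ico.1 hj).2]
    ring
  simp only [proj, interp, nodal_sum]
  rw [← Finset.sum_sub_distrib, Finset.sum_div]
  exact Finset.sum_congr rfl fun i _ => by ring

lemma abs_avg_sub_le {g : ℝ → ℝ} (hg : ContinuousOn g (Icc 0 1)) {j : ℕ} (hj : j < M.m) {c B : ℝ}
    (h : ∀ z ∈ Icc (M.x j) (M.x (j + 1)), |g z - c| ≤ B) : |M.avg N g j - c| ≤ B := by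
  have hw := M.weight_pos N hj
  refine le_of_mul_le_mul_left ?_ hw
  calc M.weight N j * |M.avg N g j - c|
      = ‖∫ y in (M.x j)..(M.x (j + 1)), y ^ (N - 1) * (g y - c)‖ := by
        rw [← weight_mul_avg_sub N hg hj, Real.norm_eq_abs, abs_mul, abs_of_pos hw]
    _ ≤ ∫ y in (M.x j)..(M.x (j + 1)), y ^ (N - 1) * B := by
        refine intervalIntegral.norm_integral_le_of_norm_le (M.x_lt j hj).le
          (.of_forall fun y hy => ?_) (M.intervalIntegrable_elem (by fun_prop) hj)
        have hp : 0 ≤ y ^ (N - 1) := pow_nonneg ((M.x_nonneg hj.le).trans hy.1.le) _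
        rw [Real.norm_eq_abs, abs_mul, abs_of_nonneg hp]
        exact mul_le_mul_of_nonneg_left (h y (Ioc_subset_Icc_self hy)) hp
    _ = M.weight N j * B := by rw [intervalIntegral.integral_mul_const, weight]

lemma MemS.formA_proj {g χ : ℝ → ℝ} (hχ : M.MemS χ) :
    formA N (M.proj N g) χ = ∑ j ∈ Finset.range M.m,
      M.slope χ j * ∫ y in (M.x j)..(M.x (j + 1)), y ^ (N - 1) * g y := by
  rw [(M.proj_memS N g).formA_eq N hχ]
  refine Finset.sum_congr rfl fun j hj => ?_
  rw [Finset.mem_range] at hj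
  rw [M.slope_proj N g hj, avg]
  field_simp [(M.weight_pos N hj).ne']

lemma MemS.formA_proj_eq {g F χ : ℝ → ℝ} (hχ : M.MemS χ) (hg : ContinuousOn g (Icc 0 1))
    (hF : ContinuousOn F (Icc 0 1)) (hg0 : g 0 = 0)
    (h_flux : ∀ z ∈ Ioo (0 : ℝ) 1,
      HasDerivAt (fun z => z ^ (N - 1) * g z) (z ^ (N - 1) * F z) z) :
    formA N (M.proj N g) χ = -ip N F χ := by
  have hχc := hχ.cont
  have by_parts : ∀ j ∈ Finset.range M.m,
      M.slope χ j * (∫ y in (M.x j)..(M.x (j + 1)), y ^ (N - 1) * g y)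
        + (∫ y in (M.x j)..(M.x (j + 1)), y ^ (N - 1) * (F y * χ y))
      = M.x (j + 1) ^ (N - 1) * g (M.x (j + 1)) * χ (M.x (j + 1))
        - M.x j ^ (N - 1) * g (M.x j) * χ (M.x j) := by
    intro j hj
    rw [Finset.mem_range] at hj
    have h_cont : ContinuousOn (fun z => z ^ (N - 1) * g z * χ z) (Icc 0 1) := by fun_prop
    rw [← intervalIntegral.integral_const_mul, ← integral_add
      (M.intervalIntegrable_elem (by fun_prop) hj) (M.intervalIntegrable_elem (by fun_prop) hj)]
    refine integral_eq_sub_of_hasDerivAt_of_le (M.x_lt j hj).le (h_cont.mono (M.elem_subset hj))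
      (fun z hz => ?_) (M.intervalIntegrable_elem (by fun_prop) hj)
    have hz01 : z ∈ Ioo (0 : ℝ) 1 :=
      ⟨(M.x_nonneg hj.le).trans_lt hz.1, hz.2.trans_le (M.x_le_one hj)⟩
    convert! (h_flux z hz01).mul (hχ.hasDerivAt hj hz) using 1
    ring
  have h_sum := Finset.sum_congr rfl by_parts
  rw [Finset.sum_add_distrib,
    Finset.sum_range_sub (fun j => M.x j ^ (N - 1) * g (M.x j) * χ (M.x j)), M.x_last, hχ.right,
    M.x_zero, hg0] at h_sum
  rw [hχ.formA_proj, ip, M.integral_eq_sum fun j hj => M.intervalIntegrable_elem (by fun_prop) hj]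
  linarith

end Projection

end Mesh

/-- The class of functions to which the error estimates for the elliptic projection apply:
`w` is differentiable on `[0, 1]`, its derivative `g` is `K`-Lipschitz, and `w 1 = 0`. -/
structure HasLipschitzDeriv (K : ℝ≥0) (w g : ℝ → ℝ) : Prop where
  hasDerivWithinAt : ∀ y ∈ Icc (0 : ℝ) 1, HasDerivWithinAt w (g y) (Icc 0 1) y
  lipschitz : LipschitzOnWith K g (Icc 0 1)
  right : w 1 = 0

namespace HasLipschitzDeriv

variable {M : Mesh} (N : ℕ) {K : ℝ≥0} {w g : ℝ → ℝ}

lemma continuousOn (H : HasLipschitzDeriv K w g) : ContinuousOn w (Icc 0 1) :=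
  fun y hy => (H.hasDerivWithinAt y hy).continuousWithinAt

lemma abs_avg_sub_le_mul_h (H : HasLipschitzDeriv K w g) {j : ℕ} (hj : j < M.m) {y : ℝ}
    (hy : y ∈ Icc (M.x j) (M.x (j + 1))) : |M.avg N g j - g y| ≤ K * M.h :=
  Mesh.abs_avg_sub_le N H.lipschitz.continuousOn hj fun z hz =>
    (H.lipschitz.dist_le_mul z (M.elem_subset hj hz) y (M.elem_subset hj hy)).trans
      (mul_le_mul_of_nonneg_left (M.abs_sub_le_h hj hz hy) K.coe_nonneg)

lemma proj_sub_sub_eq (H : HasLipschitzDeriv K w g) {j : ℕ} (hj : j < M.m) {y : ℝ}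
    (hy : y ∈ Icc (M.x j) (M.x (j + 1))) :
    (M.proj N g y - w y) - (M.proj N g (M.x (j + 1)) - w (M.x (j + 1)))
      = ∫ z in y..(M.x (j + 1)), (g z - M.avg N g j) := by
  have h_sub : Icc y (M.x (j + 1)) ⊆ Icc 0 1 :=
    (Icc_subset_Icc_left hy.1).trans (M.elem_subset hj)
  have h_int : IntervalIntegrable g volume y (M.x (j + 1)) :=
    (H.lipschitz.continuousOn.mono h_sub).intervalIntegrable_of_Icc hy.2
  have h_deriv : ∀ z ∈ Ioo y (M.x (j + 1)), HasDerivAt w (g z) z := fun z hz =>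
    (H.hasDerivWithinAt z (h_sub (Ioo_subset_Icc_self hz))).hasDerivAt (Icc_mem_nhds
      (((M.x_nonneg hj.le).trans hy.1).trans_lt hz.1) (hz.2.trans_le (M.x_le_one hj)))
  have h_proj := M.proj_memS N g
  rw [integral_sub h_int intervalIntegrable_const,
    integral_eq_sub_of_hasDerivAt_of_le hy.2 (H.continuousOn.mono h_sub) h_deriv h_int,
    intervalIntegral.integral_const, smul_eq_mul, h_proj.eq_on_elem hj hy,
    h_proj.eq_on_elem hj (right_mem_Icc.2 (M.x_lt j hj).le), M.slope_proj N g hj]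
  ring

lemma abs_proj_sub_le_add (H : HasLipschitzDeriv K w g) {j : ℕ} (hj : j < M.m) {y : ℝ}
    (hy : y ∈ Icc (M.x j) (M.x (j + 1))) :
    |M.proj N g y - w y|
      ≤ |M.proj N g (M.x (j + 1)) - w (M.x (j + 1))| + K * M.h * (M.x (j + 1) - y) := by
  have h_incr : |(M.proj N g y - w y) - (M.proj N g (M.x (j + 1)) - w (M.x (j + 1)))|
      ≤ K * M.h * (M.x (j + 1) - y) := by
    rw [H.proj_sub_sub_eq N hj hy, ← abs_of_nonneg (sub_nonneg.2 hy.2), ← Real.norm_eq_abs]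
    refine intervalIntegral.norm_integral_le_of_norm_le_const fun z hz => ?_
    rw [uIoc_of_le hy.2] at hz
    rw [Real.norm_eq_abs, abs_sub_comm]
    exact H.abs_avg_sub_le_mul_h N hj ⟨hy.1.trans hz.1.le, hz.2⟩
  linarith [abs_sub_abs_le_abs_sub (M.proj N g y - w y)
    (M.proj N g (M.x (j + 1)) - w (M.x (j + 1)))]

lemma proj_last (H : HasLipschitzDeriv K w g) : M.proj N g (M.x M.m) - w (M.x M.m) = 0 := by
  rw [M.x_last, (M.proj_memS N g).right, H.right, sub_self]

lemma abs_proj_sub_le (H : HasLipschitzDeriv K w g) {y : ℝ} (hy : y ∈ Icc (0 : ℝ) 1) :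
    |M.proj N g y - w y| ≤ K * M.h := by
  have nodal : ∀ i ≤ M.m, |M.proj N g (M.x i) - w (M.x i)| ≤ K * M.h * (1 - M.x i) := by
    intro i hi
    have h_sum := abs_le_sub_of_abs_le_succ (φ := fun i => -(K * M.h * M.x i)) (k := 0)
      (H.proj_last N) (fun j _ hj => by
        linarith [H.abs_proj_sub_le_add N hj (left_mem_Icc.2 (M.x_lt j hj).le)]) i.zero_le hi
    rw [M.x_last] at h_sum
    linarith
  obtain ⟨j, hj, hyj⟩ := M.exists_mem_elem hy
  have h_y : 0 ≤ K * M.h * y := mul_nonneg (mul_nonneg K.coe_nonneg M.h_pos.le) hy.1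
  linarith [H.abs_proj_sub_le_add N hj hyj, nodal (j + 1) hj]

lemma abs_proj_sub_sub_node_le (H : HasLipschitzDeriv K w g) {j : ℕ} (hj : j < M.m) :
    |(M.proj N g (M.x j) - w (M.x j)) - (M.proj N g (M.x (j + 1)) - w (M.x (j + 1)))|
      ≤ (N - 1 : ℕ) * K * M.h ^ 2 * (M.step j / M.x (j + 1)) := by
  have hlt := M.x_lt j hj
  have hb : 0 < M.x (j + 1) := (M.x_nonneg hj.le).trans_lt hlt
  rw [H.proj_sub_sub_eq N hj (left_mem_Icc.2 hlt.le),
    Mesh.integral_sub_avg_eq N H.lipschitz.continuousOn hj (M.x (j + 1))]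
  have h_bound : ∀ z ∈ uIoc (M.x j) (M.x (j + 1)),
      ‖(1 - (z / M.x (j + 1)) ^ (N - 1)) * (g z - M.avg N g j)‖
        ≤ ((N - 1 : ℕ) * (M.h / M.x (j + 1))) * (K * M.h) := by
    intro z hz
    rw [uIoc_of_le hlt.le] at hz
    have hz0 : 0 ≤ z / M.x (j + 1) := div_nonneg ((M.x_nonneg hj.le).trans hz.1.le) hb.le
    have hz1 : 1 - z / M.x (j + 1) ≤ M.h / M.x (j + 1) := by
      rw [one_sub_div hb.ne']
      gcongr
      exact (sub_le_sub_left hz.1.le _).trans (M.step_le_h hj)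
    rw [norm_mul, Real.norm_of_nonneg (sub_nonneg.2 (pow_le_one₀ hz0 ((div_le_one hb).2 hz.2))),
      Real.norm_eq_abs, abs_sub_comm]
    exact mul_le_mul ((one_sub_pow_le hz0 _).trans (by gcongr))
      (H.abs_avg_sub_le_mul_h N hj (Ioc_subset_Icc_self hz)) (abs_nonneg _)
      (mul_nonneg (Nat.cast_nonneg _) (div_nonneg M.h_pos.le hb.le))
  refine (intervalIntegral.norm_integral_le_of_norm_le_const h_bound).trans_eq ?_
  rw [← Mesh.step, abs_of_pos (M.step_pos hj)]
  ring

lemma abs_proj_sub_node_le (H : HasLipschitzDeriv K w g) {i : ℕ} (hi : 1 ≤ i) (him : i ≤ M.m) :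
    |M.proj N g (M.x i) - w (M.x i)| ≤ (N - 1 : ℕ) * K * M.h ^ 2 * (2 / √(M.x i)) := by
  have h_sum := abs_le_sub_of_abs_le_succ (r := fun i => M.proj N g (M.x i) - w (M.x i))
    (φ := fun i => (N - 1 : ℕ) * K * M.h ^ 2 * (2 / √(M.x i))) (H.proj_last N) (fun j hj1 hj => by
      have hx : 0 < M.x j :=
        M.x_zero.symm.trans_lt ((M.x_lt 0 M.m_pos).trans_le (M.x_mono hj1 hj.le))
      have h_step := mul_le_mul_of_nonneg_left
        (sub_div_le_sqrt hx (M.x_lt j hj).le (M.x_le_one hj))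
        (show 0 ≤ (N - 1 : ℕ) * K * M.h ^ 2 by positivity)
      rw [← Mesh.step, mul_sub] at h_step
      linarith [H.abs_proj_sub_sub_node_le N hj,
        abs_sub_abs_le_abs_sub (M.proj N g (M.x j) - w (M.x j))
          (M.proj N g (M.x (j + 1)) - w (M.x (j + 1)))]) hi him
  exact h_sum.trans (sub_le_self _ (by positivity))

lemma sqrt_weight_mul_abs_proj_sub_le (H : HasLipschitzDeriv K w g) {j : ℕ} (hj : j < M.m)
    {y z : ℝ} (hy : y ∈ Icc (M.x j) (M.x (j + 1))) (hz : z ∈ Icc (M.x j) (M.x (j + 1))) :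
    √(z ^ (N - 1)) * |M.proj N g y - w y| ≤ (2 * N + 1) * K * M.h ^ 2 := by
  have hz01 := M.elem_subset hj hz
  have hb : 0 < √(M.x (j + 1)) :=
    Real.sqrt_pos.2 ((M.x_nonneg hj.le).trans_lt (M.x_lt j hj))
  have h_point : |M.proj N g y - w y|
      ≤ (N - 1 : ℕ) * K * M.h ^ 2 * (2 / √(M.x (j + 1))) + K * M.h ^ 2 := by
    have h_step : K * M.h * (M.x (j + 1) - y) ≤ K * M.h * M.h :=
      mul_le_mul_of_nonneg_left ((sub_le_sub_left hy.1 _).trans (M.step_le_h hj))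
        (mul_nonneg K.coe_nonneg M.h_pos.le)
    linarith [H.abs_proj_sub_le_add N hj hy, H.abs_proj_sub_node_le N (Nat.le_add_left 1 j) hj]
  have weight_le_one : √(z ^ (N - 1)) ≤ 1 := Real.sqrt_le_one.2 (pow_le_one₀ hz01.1 hz01.2)
  have weight_le : (N - 1 : ℕ) * √(z ^ (N - 1)) ≤ N * √(M.x (j + 1)) := by
    rcases (N - 1).eq_zero_or_pos with h0 | hpos
    · rw [h0, Nat.cast_zero, zero_mul]
      positivity
    · gcongr
      · omega
      · exact (pow_le_of_le_one hz01.1 hz01.2 hpos.ne').trans hz.2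
  calc √(z ^ (N - 1)) * |M.proj N g y - w y|
      ≤ √(z ^ (N - 1)) * ((N - 1 : ℕ) * K * M.h ^ 2 * (2 / √(M.x (j + 1))) + K * M.h ^ 2) := by
        gcongr
    _ = (N - 1 : ℕ) * √(z ^ (N - 1)) * (2 * K * M.h ^ 2 / √(M.x (j + 1)))
        + √(z ^ (N - 1)) * (K * M.h ^ 2) := by ring
    _ ≤ N * √(M.x (j + 1)) * (2 * K * M.h ^ 2 / √(M.x (j + 1))) + 1 * (K * M.h ^ 2) := by gcongr
    _ = (2 * N + 1) * K * M.h ^ 2 := by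
        field_simp

end HasLipschitzDeriv

/-! ### Regularity of the exact solution -/

lemma abs_le_maxNorm {α : Type*} [TopologicalSpace α] {s : Set α} (hs : IsCompact s) {v : α → ℝ}
    (hv : ContinuousOn v s) {p : α} (hp : p ∈ s) : |v p| ≤ maxNorm s v :=
  le_csSup (hs.image_of_continuousOn hv.abs).bddAbove ⟨p, hp, rfl⟩

lemma maxNorm_nonneg {α : Type*} (s : Set α) (v : α → ℝ) : 0 ≤ maxNorm s v := by
  refine Real.sSup_nonneg ?_
  rintro _ ⟨p, _, rfl⟩
  exact abs_nonneg _

lemma maxNorm_le {α : Type*} {s : Set α} {v : α → ℝ} {B : ℝ} (hs : s.Nonempty)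
    (h : ∀ p ∈ s, |v p| ≤ B) : maxNorm s v ≤ B :=
  csSup_le (hs.image _) (forall_mem_image.2 h)

lemma isCompact_cylinder (T : ℝ) : IsCompact (cylinder T) := isCompact_Icc.prod isCompact_Icc

section Cylinder

variable {T : ℝ} {K : ℝ≥0} {v : ℝ × ℝ → ℝ}

lemma continuousOn_slice (h : ContinuousOn v (cylinder T)) {t : ℝ} (ht : t ∈ Icc 0 T) :
    ContinuousOn (fun y => v (y, t)) (Icc 0 1) :=
  h.comp (by fun_prop) fun _ hy => ⟨hy, ht⟩

lemma HasContDx.hasDerivWithinAt (h : HasContDx T v) {t : ℝ} (ht : t ∈ Icc 0 T) {y : ℝ}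
    (hy : y ∈ Icc (0 : ℝ) 1) :
    HasDerivWithinAt (fun y => v (y, t)) (dx v (y, t)) (Icc 0 1) y :=
  (h.1 t ht y hy).hasDerivWithinAt

lemma HasContDt.hasDerivWithinAt (h : HasContDt T v) {t : ℝ} (ht : t ∈ Icc 0 T) {y : ℝ}
    (hy : y ∈ Icc (0 : ℝ) 1) :
    HasDerivWithinAt (fun s => v (y, s)) (dt T v (y, t)) (Icc 0 T) t :=
  (h.1 y hy t ht).hasDerivWithinAt

lemma HasContDt.lipschitzOnWith (h : HasContDt T v) (hB : ∀ p ∈ cylinder T, |dt T v p| ≤ K)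
    {y : ℝ} (hy : y ∈ Icc (0 : ℝ) 1) : LipschitzOnWith K (fun s => v (y, s)) (Icc 0 T) :=
  (convex_Icc 0 T).lipschitzOnWith_of_nnnorm_hasDerivWithin_le
    (fun _ ht => h.hasDerivWithinAt ht hy) fun _ ht => hB _ ⟨hy, ht⟩

/-- The difference quotient of `v` with respect to time, with increment `τ`. -/
noncomputable def quot (v : ℝ × ℝ → ℝ) (t τ y : ℝ) : ℝ := (v (y, t + τ) - v (y, t)) / τ

lemma HasContDt.abs_quot_le (h : HasContDt T v) (hB : ∀ p ∈ cylinder T, |dt T v p| ≤ K) {t τ : ℝ}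
    (hτ : 0 < τ) (ht : t ∈ Icc 0 T) (ht' : t + τ ∈ Icc 0 T) {y : ℝ} (hy : y ∈ Icc (0 : ℝ) 1) :
    |quot v t τ y| ≤ K := by
  have h_lip := (h.lipschitzOnWith hB hy).dist_le_mul _ ht' _ ht
  rw [Real.dist_eq, Real.dist_eq, add_sub_cancel_left, abs_of_pos hτ] at h_lip
  rwa [quot, abs_div, abs_of_pos hτ, div_le_iff₀ hτ]

lemma HasContDx.hasDerivWithinAt_quot (h : HasContDx T v) {t τ : ℝ} (ht : t ∈ Icc 0 T)
    (ht' : t + τ ∈ Icc 0 T) {y : ℝ} (hy : y ∈ Icc (0 : ℝ) 1) :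
    HasDerivWithinAt (quot v t τ) (quot (dx v) t τ y) (Icc 0 1) y :=
  ((h.hasDerivWithinAt ht' hy).sub (h.hasDerivWithinAt ht hy)).div_const τ

lemma HasContDt.abs_dt_sub_quot_le (h : HasContDt T v) (h' : HasContDt T (dt T v))
    (hB : ∀ p ∈ cylinder T, |dt T (dt T v) p| ≤ K) {t τ : ℝ} (hτ : 0 < τ) (ht : t ∈ Icc 0 T)
    (ht' : t + τ ∈ Icc 0 T) {y : ℝ} (hy : y ∈ Icc (0 : ℝ) 1) :
    |dt T v (y, t + τ) - quot v t τ y| ≤ K * τ := by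
  have h_sub : Icc t (t + τ) ⊆ Icc 0 T := Icc_subset_Icc ht.1 ht'.2
  have h_le : t ≤ t + τ := by linarith
  have taylor := (convex_Icc t (t + τ)).norm_image_sub_le_of_norm_hasDerivWithin_le
    (f := fun s => v (y, s) - s * dt T v (y, t + τ)) (C := K * τ)
    (fun s hs => ((h.hasDerivWithinAt (h_sub hs) hy).mono h_sub).sub
      ((hasDerivWithinAt_id s _).mul_const _))
    (fun s hs => by
      rw [one_mul]
      refine ((h'.lipschitzOnWith hB hy).dist_le_mul s (h_sub hs) _ ht').trans ?_
      gcongr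
      rw [Real.dist_eq, abs_le]
      constructor <;> linarith [hs.1, hs.2])
    (left_mem_Icc.2 h_le) (right_mem_Icc.2 h_le)
  rw [Real.norm_eq_abs, Real.norm_eq_abs, add_sub_cancel_left, abs_of_pos hτ] at taylor
  have h_eq : dt T v (y, t + τ) - quot v t τ y
      = -(v (y, t + τ) - (t + τ) * dt T v (y, t + τ) - (v (y, t) - t * dt T v (y, t + τ))) / τ := by
    rw [quot]
    field_simp
    ring
  rwa [h_eq, abs_div, abs_neg, abs_of_pos hτ, div_le_iff₀ hτ]

end Cylinder

/-- `u` is smooth on `Q_T`, and those of its derivatives in `κ(u)` that enter the error estimate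
are bounded by `K` in absolute value. -/
structure IsSmoothBy (T : ℝ) (K : ℝ≥0) (u : ℝ × ℝ → ℝ) : Prop extends IsSmooth T u where
  abs_le : ∀ p ∈ cylinder T, |u p| ≤ K
  abs_dxx_le : ∀ p ∈ cylinder T, |dx (dx u) p| ≤ K
  abs_dt_le : ∀ p ∈ cylinder T, |dt T u p| ≤ K
  abs_dtt_le : ∀ p ∈ cylinder T, |dt T (dt T u) p| ≤ K
  abs_dtx_le : ∀ p ∈ cylinder T, |dt T (dx u) p| ≤ K
  abs_dtxx_le : ∀ p ∈ cylinder T, |dt T (dx (dx u)) p| ≤ K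

section ExactSolution

variable {T : ℝ} {K : ℝ≥0} {u : ℝ × ℝ → ℝ} {N : ℕ} {f u0 : ℝ → ℝ}

lemma IsSmooth.isSmoothBy (hu : IsSmooth T u) (hK : kappa T u ≤ K) : IsSmoothBy T K u := by
  have h_nonneg := maxNorm_nonneg (cylinder T)
  have le_of_maxNorm_le {v : ℝ × ℝ → ℝ} (hv : ContinuousOn v (cylinder T))
      (h : maxNorm (cylinder T) v ≤ kappa T u) : ∀ p ∈ cylinder T, |v p| ≤ K :=
    fun p hp => ((abs_le_maxNorm (isCompact_cylinder T) hv hp).trans h).trans hK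
  refine ⟨hu, le_of_maxNorm_le hu.cont ?_, le_of_maxNorm_le hu.u_xx.2 ?_,
    le_of_maxNorm_le hu.u_t.2 ?_, le_of_maxNorm_le hu.u_tt.2 ?_, le_of_maxNorm_le hu.u_tx.2 ?_,
    le_of_maxNorm_le hu.u_txx.2 ?_⟩ <;>
  · rw [kappa]
    linarith [h_nonneg u, h_nonneg (dx u), h_nonneg (dx (dx u)), h_nonneg (dt T u),
      h_nonneg (dt T (dt T u)), h_nonneg (dt T (dx u)), h_nonneg (dt T (dx (dx u)))]

lemma IsSmooth.continuousOn_dt_sub_comp (hu : IsSmooth T u) (hf : Continuous f) {t : ℝ}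
    (ht : t ∈ Icc 0 T) :
    ContinuousOn (fun y => dt T u (y, t) - f (u (y, t))) (Icc 0 1) :=
  (continuousOn_slice hu.u_t.2 ht).sub (hf.comp_continuousOn (continuousOn_slice hu.cont ht))

lemma IsSolution.dirichlet_Icc (hs : IsSolution N f u0 T u) (hu : IsSmooth T u) (hT : 0 < T)
    {t : ℝ} (ht : t ∈ Icc 0 T) : u (1, t) = 0 := by
  have h_cont : ContinuousOn (fun s => u (1, s)) (Icc 0 T) :=
    hu.cont.comp (by fun_prop) fun s hs => ⟨right_mem_Icc.2 zero_le_one, hs⟩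
  exact EqOn.of_subset_closure hs.dirichlet h_cont continuousOn_const Ioc_subset_Icc_self
    (closure_Ioc hT.ne).ge ht

lemma IsSolution.initial_Icc (hs : IsSolution N f u0 T u) (hu : IsSmooth T u) (hT : 0 < T)
    (hu0 : ContinuousOn u0 (Icc 0 1)) {y : ℝ} (hy : y ∈ Icc (0 : ℝ) 1) : u (y, 0) = u0 y :=
  EqOn.of_subset_closure (f := fun y => u (y, 0)) hs.initial
    (continuousOn_slice hu.cont (left_mem_Icc.2 hT.le)) hu0 Ioo_subset_Icc_self
    (closure_Ioo zero_ne_one).ge hy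

lemma IsSolution.hasDerivAt_flux (hN : 1 ≤ N) (hs : IsSolution N f u0 T u) (hu : IsSmooth T u)
    {t : ℝ} (ht : t ∈ Ioc 0 T) {z : ℝ} (hz : z ∈ Ioo (0 : ℝ) 1) :
    HasDerivAt (fun z => z ^ (N - 1) * dx u (z, t))
      (z ^ (N - 1) * (dt T u (z, t) - f (u (z, t)))) z := by
  have h_dx := (hu.u_xx.hasDerivWithinAt (Ioc_subset_Icc_self ht)
    (Ioo_subset_Icc_self hz)).hasDerivAt (Icc_mem_nhds hz.1 hz.2)
  convert! (hasDerivAt_pow (N - 1) z).mul h_dx using 1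
  rw [hs.pde z hz t ht]
  have hz0 := hz.1.ne'
  rcases N with _ | _ | k
  · omega
  · simp
  · simp only [Nat.add_sub_cancel]
    push_cast
    field_simp
    ring

lemma IsSolution.hasLipschitzDeriv (hs : IsSolution N f u0 T u) (hu : IsSmoothBy T K u)
    (hT : 0 < T) {t : ℝ} (ht : t ∈ Icc 0 T) :
    HasLipschitzDeriv K (fun y => u (y, t)) (fun y => dx u (y, t)) where
  hasDerivWithinAt _ hy := hu.u_x.hasDerivWithinAt ht hy
  lipschitz := (convex_Icc 0 1).lipschitzOnWith_of_nnnorm_hasDerivWithin_le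
    (fun _ hy => hu.u_xx.hasDerivWithinAt ht hy) fun _ hy => hu.abs_dxx_le _ ⟨hy, ht⟩
  right := hs.dirichlet_Icc hu.toIsSmooth hT ht

lemma IsSolution.hasLipschitzDeriv_quot (hs : IsSolution N f u0 T u) (hu : IsSmoothBy T K u)
    (hT : 0 < T) {t τ : ℝ} (hτ : 0 < τ) (ht : t ∈ Icc 0 T) (ht' : t + τ ∈ Icc 0 T) :
    HasLipschitzDeriv K (quot u t τ) (quot (dx u) t τ) where
  hasDerivWithinAt _ hy := hu.u_x.hasDerivWithinAt_quot ht ht' hy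
  lipschitz := (convex_Icc 0 1).lipschitzOnWith_of_nnnorm_hasDerivWithin_le
    (fun _ hy => hu.u_xx.hasDerivWithinAt_quot ht ht' hy)
    fun _ hy => hu.u_txx.abs_quot_le hu.abs_dtxx_le hτ ht ht' hy
  right := by
    have h_right {s : ℝ} (h : s ∈ Icc 0 T) := hs.dirichlet_Icc hu.toIsSmooth hT h
    rw [quot, h_right ht, h_right ht', sub_self, zero_div]

end ExactSolution

/-! ### The discrete error -/

lemma time_zero (τ : ℕ → ℝ) : time τ 0 = 0 := Finset.sum_range_zero _

lemma time_succ (τ : ℕ → ℝ) (n : ℕ) : time τ (n + 1) = time τ n + τ n :=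
  Finset.sum_range_succ _ _

lemma time_nonneg {τ : ℕ → ℝ} (hτ : ∀ j, 0 < τ j) (n : ℕ) : 0 ≤ time τ n :=
  Finset.sum_nonneg fun j _ => (hτ j).le

/-- Discrete Gronwall inequality. The recursion is assumed only while `a n` obeys the bound to be
proved: for the maximum norm of the error it is available only while that norm is at most `1`. -/
lemma le_exp_mul_of_succ_le {τ a : ℕ → ℝ} {T c A b : ℝ} (hτ : ∀ j, 0 < τ j) (hc : 0 ≤ c)
    (hA : 0 ≤ A) (hb : 0 ≤ b) (h_zero : a 0 ≤ A)
    (h_succ : ∀ n, time τ (n + 1) ≤ T → a n ≤ Real.exp (c * T) * (A + T * b) →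
      a (n + 1) ≤ (1 + c * τ n) * a n + τ n * b) {n : ℕ} (hn : time τ n ≤ T) :
    a n ≤ Real.exp (c * T) * (A + T * b) := by
  have bound_mono {n : ℕ} (hn : time τ n ≤ T) :
      Real.exp (c * time τ n) * (A + time τ n * b) ≤ Real.exp (c * T) * (A + T * b) := by
    have := time_nonneg hτ n
    gcongr
  suffices h : ∀ n, time τ n ≤ T → a n ≤ Real.exp (c * time τ n) * (A + time τ n * b) from
    (h n hn).trans (bound_mono hn)
  intro n
  induction n with
  | zero => simpa [time_zero] using fun _ => h_zero
  | succ n ih =>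
    intro hn
    have h_time := time_succ τ n
    have hτn := (hτ n).le
    have ht := time_nonneg hτ n
    have hn' : time τ n ≤ T := by linarith
    calc a (n + 1) ≤ (1 + c * τ n) * a n + τ n * b :=
          h_succ n hn ((ih hn').trans (bound_mono hn'))
      _ ≤ Real.exp (c * τ n) * (Real.exp (c * time τ n) * (A + time τ n * b))
          + Real.exp (c * time τ (n + 1)) * (τ n * b) := by
        refine add_le_add (mul_le_mul_of_nonneg_left (ih hn') (by positivity) |>.trans ?_) ?_
        · gcongr
          linarith [Real.add_one_le_exp (c * τ n)]
        · exact le_mul_of_one_le_left (mul_nonneg hτn hb)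
            (Real.one_le_exp (mul_nonneg hc (time_nonneg hτ _)))
      _ = Real.exp (c * time τ (n + 1)) * (A + time τ (n + 1) * b) := by
        rw [h_time, mul_add c, Real.exp_add]
        ring

/-- The component `θ^n = u_h^n - P u(·, t_n)` of the error that lies in the finite element space,
where `P` is the elliptic projection. -/
noncomputable def err (N : ℕ) (M : Mesh) (u : ℝ × ℝ → ℝ) (τ : ℕ → ℝ) (U : ℕ → ℝ → ℝ) (n : ℕ)
    (y : ℝ) : ℝ :=
  U n y - M.proj N (fun z => dx u (z, time τ n)) y

/-- The right hand side of the equation for `err`: what remains of the nonlinear terms after the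
elliptic projection has absorbed the spatial part of the differential equation at `t_{n+1}`. -/
noncomputable def load (f : ℝ → ℝ) (T : ℝ) (u : ℝ × ℝ → ℝ) (τ : ℕ → ℝ) (U : ℕ → ℝ → ℝ) (n : ℕ)
    (y : ℝ) : ℝ :=
  f (U n y) + (dt T u (y, time τ n + τ n) - f (u (y, time τ n + τ n)))

/-- The setting of the error analysis: `U` is computed by (ML-1) on the mesh `M` with time
increments `τ j ≤ τmax`, and approximates the solution `u`, which is smooth with bound `K`. -/
structure IsApproximation (N : ℕ) (f u0 : ℝ → ℝ) (T : ℝ) (K : ℝ≥0) (u : ℝ × ℝ → ℝ) (M : Mesh)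
    (τ : ℕ → ℝ) (τmax : ℝ) (U : ℕ → ℝ → ℝ) : Prop where
  time_pos : 0 < T
  solution : IsSolution N f u0 T u
  smooth : IsSmoothBy T K u
  scheme : IsML1 N f M τ U
  incr_pos : ∀ j, 0 < τ j
  incr_le : ∀ j, τ j ≤ τmax

/-- The constant `C` of the error estimate: the square root of twice the energy bound for `err`
plus twice the squared constant `(2N + 1) K` of the elliptic projection. -/
noncomputable def errorConst (N : ℕ) (T C₀ : ℝ) (K L : ℝ≥0) : ℝ :=
  √(2 * (Real.exp ((2 + 4 * L ^ 2) * T)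
    * ((C₀ + (2 * N + 1) * K) ^ 2 + T * (6 * ((L + 1) * ((2 * N + 1) * K)) ^ 2)))
    + 2 * ((2 * N + 1) * K) ^ 2)

lemma errorConst_pos {N : ℕ} {T C₀ : ℝ} {K L : ℝ≥0} (hT : 0 ≤ T) (hC₀ : 0 < C₀) :
    0 < errorConst N T C₀ K L := by
  unfold errorConst
  positivity

namespace IsApproximation

variable {N : ℕ} {f u0 : ℝ → ℝ} {T : ℝ} {K L : ℝ≥0} {u : ℝ × ℝ → ℝ} {M : Mesh} {τ : ℕ → ℝ}
  {τmax : ℝ} {U : ℕ → ℝ → ℝ} {n : ℕ} {y C₀ : ℝ}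

local notation "θ" => err N M u τ U

variable (H : IsApproximation N f u0 T K u M τ τmax U)
include H

lemma incr_max_nonneg : 0 ≤ τmax := (H.incr_pos 0).le.trans (H.incr_le 0)

lemma time_mem (hn : time τ n ≤ T) : time τ n ∈ Icc 0 T := ⟨time_nonneg H.incr_pos n, hn⟩

lemma time_mem_of_succ (hn : time τ (n + 1) ≤ T) : time τ n ∈ Icc 0 T :=
  H.time_mem (by linarith [time_succ τ n, H.incr_pos n])

lemma time_add_mem (hn : time τ (n + 1) ≤ T) : time τ n + τ n ∈ Icc 0 T :=
  time_succ τ n ▸ H.time_mem hn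

lemma err_memS (n : ℕ) : M.MemS (θ n) := (H.scheme.mem n).sub (M.proj_memS N _)

lemma abs_err_le_maxNorm (hy : y ∈ Icc (0 : ℝ) 1) : |θ n y| ≤ maxNorm (Icc 0 1) (θ n) :=
  abs_le_maxNorm isCompact_Icc (H.err_memS n).cont hy

lemma lump_err_nonneg (n : ℕ) : 0 ≤ M.lump N (θ n) (θ n) :=
  (ip_nonneg fun _ _ => mul_self_nonneg _).trans ((H.err_memS n).ip_self_le_lump N)

lemma hasLipschitzDeriv (ht : time τ n ∈ Icc 0 T) :
    HasLipschitzDeriv K (fun y => u (y, time τ n)) (fun y => dx u (y, time τ n)) :=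
  H.solution.hasLipschitzDeriv H.smooth H.time_pos ht

lemma hasLipschitzDeriv_quot (hn : time τ (n + 1) ≤ T) :
    HasLipschitzDeriv K (quot u (time τ n) (τ n)) (quot (dx u) (time τ n) (τ n)) :=
  H.solution.hasLipschitzDeriv_quot H.smooth H.time_pos (H.incr_pos n) (H.time_mem_of_succ hn)
    (H.time_add_mem hn)

lemma abs_quot_dx_le (hn : time τ (n + 1) ≤ T) (hy : y ∈ Icc (0 : ℝ) 1) :
    |quot (dx u) (time τ n) (τ n) y| ≤ K :=
  H.smooth.u_tx.abs_quot_le H.smooth.abs_dtx_le (H.incr_pos n) (H.time_mem_of_succ hn)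
    (H.time_add_mem hn) hy

lemma continuousOn_load (hf : Continuous f) (hn : time τ (n + 1) ≤ T) :
    ContinuousOn (load f T u τ U n) (Icc 0 1) :=
  (hf.comp_continuousOn (H.scheme.mem n).cont).add
    (H.smooth.continuousOn_dt_sub_comp hf (H.time_add_mem hn))

lemma lump_err_quot (hn : time τ (n + 1) ≤ T) (χ : ℝ → ℝ) :
    M.lump N (fun y => (θ (n + 1) y - θ n y) / τ n) χ
      = M.lump N (fun y => (U (n + 1) y - U n y) / τ n) χ
        - M.lump N (M.proj N (quot (dx u) (time τ n) (τ n))) χ := by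
  have proj_quot (y : ℝ) : M.proj N (quot (dx u) (time τ n) (τ n)) y
      = (M.proj N (fun z => dx u (z, time τ n + τ n)) y
        - M.proj N (fun z => dx u (z, time τ n)) y) / τ n :=
    Mesh.proj_sub_div N (continuousOn_slice H.smooth.u_x.2 (H.time_add_mem hn))
      (continuousOn_slice H.smooth.u_x.2 (H.time_mem_of_succ hn)) _ y
  simp only [Mesh.lump]
  rw [← Finset.sum_sub_distrib]
  refine Finset.sum_congr rfl fun i _ => ?_
  rw [proj_quot, err, err, time_succ]
  ring

lemma implicitStep (hN : 1 ≤ N) (hf : Continuous f) (hn : time τ (n + 1) ≤ T) :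
    M.ImplicitStep N (τ n) (load f T u τ U n) (M.proj N (quot (dx u) (time τ n) (τ n)))
      (θ n) (θ (n + 1)) := by
  intro χ hχ
  have h_time := H.time_add_mem hn
  have h_pos : time τ n + τ n ∈ Ioc 0 T :=
    ⟨add_pos_of_nonneg_of_pos (time_nonneg H.incr_pos n) (H.incr_pos n), h_time.2⟩
  have h_scheme := H.scheme.scheme n χ hχ
  have h_form : formA N (θ (n + 1)) χ = formA N (U (n + 1)) χ
      - formA N (M.proj N fun z => dx u (z, time τ n + τ n)) χ := by
    rw [← time_succ]
    exact (H.scheme.mem (n + 1)).formA_sub N (M.proj_memS N _) hχ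
  have h_cont := H.smooth.continuousOn_dt_sub_comp hf h_time
  have h_proj := hχ.formA_proj_eq N (continuousOn_slice H.smooth.u_x.2 h_time) h_cont
    (H.solution.neumann _ h_pos) fun z hz =>
      H.solution.hasDerivAt_flux hN H.smooth.toIsSmooth h_pos hz
  have h_load : ip N (fun y => f (U n y)) χ = ip N (load f T u τ U n) χ
      - ip N (fun y => dt T u (y, time τ n + τ n) - f (u (y, time τ n + τ n))) χ := by
    rw [← ip_sub (H.continuousOn_load hf hn) h_cont hχ.cont]
    simp only [load, add_sub_cancel_right]
  rw [H.lump_err_quot hn, h_form, h_proj]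
  linarith

lemma abs_load_sub_quot_le (hL : LipschitzOnWith L f (Icc (-(2 * K + 1) : ℝ) (2 * K + 1)))
    (hh : M.h ≤ 1) (hn : time τ (n + 1) ≤ T) (h_small : maxNorm (Icc 0 1) (θ n) ≤ 1)
    (hy : y ∈ Icc (0 : ℝ) 1) :
    |load f T u τ U n y - quot u (time τ n) (τ n) y|
      ≤ L * (|θ n y| + |M.proj N (fun z => dx u (z, time τ n)) y - u (y, time τ n)|)
        + (L + 1) * K * τ n := by
  have ht := H.time_mem_of_succ hn
  have ht' := H.time_add_mem hn
  have hτn := H.incr_pos n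
  set r := M.proj N (fun z => dx u (z, time τ n)) y - u (y, time τ n) with hr
  have h_split : U n y = θ n y + r + u (y, time τ n) := by
    rw [err, hr]
    ring
  have u_le := abs_le.1 (H.smooth.abs_le (y, time τ n) ⟨hy, ht⟩)
  have u_le' := abs_le.1 (H.smooth.abs_le (y, time τ n + τ n) ⟨hy, ht'⟩)
  have θ_le := abs_le.1 ((H.abs_err_le_maxNorm hy).trans h_small)
  have r_le : -(K : ℝ) ≤ r ∧ r ≤ K := abs_le.1 <|
    ((H.hasLipschitzDeriv ht).abs_proj_sub_le N hy).trans (mul_le_of_le_one_right K.2 hh)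
  have f_sub_le : |f (U n y) - f (u (y, time τ n + τ n))|
      ≤ L * |U n y - u (y, time τ n + τ n)| :=
    hL.dist_le_mul _ ⟨by linarith, by linarith⟩ _
      ⟨by linarith [K.coe_nonneg], by linarith [K.coe_nonneg]⟩
  have u_sub_le : |u (y, time τ n) - u (y, time τ n + τ n)| ≤ K * τ n := by
    simpa [Real.dist_eq, abs_of_pos hτn]
      using (H.smooth.u_t.lipschitzOnWith H.smooth.abs_dt_le hy).dist_le_mul _ ht _ ht'
  have dt_sub_le := H.smooth.u_t.abs_dt_sub_quot_le H.smooth.u_tt H.smooth.abs_dtt_le hτn ht ht' hy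
  calc |load f T u τ U n y - quot u (time τ n) (τ n) y|
      = |(f (U n y) - f (u (y, time τ n + τ n)))
          + (dt T u (y, time τ n + τ n) - quot u (time τ n) (τ n) y)| := by
        rw [load]
        ring_nf
    _ ≤ L * |U n y - u (y, time τ n + τ n)| + K * τ n :=
        (abs_add_le _ _).trans (add_le_add f_sub_le dt_sub_le)
    _ ≤ L * (|θ n y| + |r| + K * τ n) + K * τ n := by
        rw [h_split, add_sub_assoc]
        gcongr
        exact (abs_add_three _ _ _).trans (by gcongr)
    _ = L * (|θ n y| + |r|) + (L + 1) * K * τ n := by ring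

lemma maxNorm_err_succ_le (hN : 1 ≤ N) (hf : Continuous f)
    (hL : LipschitzOnWith L f (Icc (-(2 * K + 1) : ℝ) (2 * K + 1))) (hh : M.h ≤ 1)
    (hn : time τ (n + 1) ≤ T) (h_small : maxNorm (Icc 0 1) (θ n) ≤ 1) :
    maxNorm (Icc 0 1) (θ (n + 1)) ≤ (1 + L * τ n) * maxNorm (Icc 0 1) (θ n)
      + τ n * ((L + 2) * K * (M.h + τmax)) := by
  have hτ0 := H.incr_max_nonneg
  have h_pos := M.h_pos
  have h_norm := maxNorm_nonneg (Icc 0 1) (θ n)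
  set q := quot u (time τ n) (τ n)
  set W := M.proj N (quot (dx u) (time τ n) (τ n))
  have residual_le : ∀ i < M.m, ∀ y ∈ Icc (0 : ℝ) 1, M.hat i y ≠ 0 →
      |load f T u τ U n y - W (M.x i)|
        ≤ L * maxNorm (Icc 0 1) (θ n) + (L + 2) * K * (M.h + τmax) := by
    intro i hi y hy hne
    have hx := M.x_mem_Icc hi.le
    have q_sub_le : |q y - q (M.x i)| ≤ K * M.h :=
      ((convex_Icc 0 1).norm_image_sub_le_of_norm_hasDerivWithin_le
        (H.hasLipschitzDeriv_quot hn).hasDerivWithinAt (fun z hz => H.abs_quot_dx_le hn hz)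
        hx hy).trans (by gcongr; exact M.abs_sub_node_le_h hi hy hne)
    have W_sub_le : |W (M.x i) - q (M.x i)| ≤ K * M.h :=
      (H.hasLipschitzDeriv_quot hn).abs_proj_sub_le N hx
    rw [abs_sub_comm] at W_sub_le
    have r_le := (H.hasLipschitzDeriv (H.time_mem_of_succ hn)).abs_proj_sub_le (M := M) N hy
    calc |load f T u τ U n y - W (M.x i)|
        = |(load f T u τ U n y - q y) + (q y - q (M.x i)) + (q (M.x i) - W (M.x i))| := by
          ring_nf
      _ ≤ (L * (maxNorm (Icc 0 1) (θ n) + K * M.h) + (L + 1) * K * τmax) + K * M.h + K * M.h := by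
          refine (abs_add_three _ _ _).trans ?_
          gcongr
          refine (H.abs_load_sub_quot_le hL hh hn h_small hy).trans ?_
          gcongr
          exacts [H.abs_err_le_maxNorm hy, H.incr_le n]
      _ ≤ L * maxNorm (Icc 0 1) (θ n) + (L + 2) * K * (M.h + τmax) := by
          linarith [mul_nonneg K.coe_nonneg hτ0]
  have nodal_le := (H.implicitStep hN hf hn).abs_node_le (H.incr_pos n) (H.err_memS (n + 1))
    (H.continuousOn_load hf hn) (by positivity)
    (fun i hi => H.abs_err_le_maxNorm (M.x_mem_Icc hi)) residual_le
  refine (maxNorm_le (nonempty_Icc.2 zero_le_one) fun y hy =>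
    (H.err_memS (n + 1)).abs_le_of_nodal nodal_le hy).trans_eq ?_
  ring

lemma maxNorm_err_zero_le (hC₀ : 0 ≤ C₀) (hh : M.h ≤ 1)
    (h_init : ∀ y ∈ Icc (0 : ℝ) 1, |U 0 y - u (y, 0)| ≤ C₀ * M.h ^ 2) :
    maxNorm (Icc 0 1) (θ 0) ≤ (C₀ + K) * M.h := by
  refine maxNorm_le (nonempty_Icc.2 zero_le_one) fun y hy => ?_
  have h_proj := (H.hasLipschitzDeriv (H.time_mem (time_zero τ ▸ H.time_pos.le))).abs_proj_sub_le
    (M := M) N hy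
  simp only [time_zero] at h_proj
  have h_sq : C₀ * M.h ^ 2 ≤ C₀ * M.h :=
    mul_le_mul_of_nonneg_left (pow_le_of_le_one M.h_pos.le hh two_ne_zero) hC₀
  rw [err, time_zero]
  linarith [h_init y hy, abs_sub_le (U 0 y) (u (y, 0)) (M.proj N (fun z => dx u (z, 0)) y),
    abs_sub_comm (u (y, 0)) (M.proj N (fun z => dx u (z, 0)) y)]

lemma lump_err_zero_le
    (h_init : ∀ y ∈ Icc (0 : ℝ) 1, |U 0 y - u (y, 0)| ≤ C₀ * M.h ^ 2) :
    M.lump N (θ 0) (θ 0) ≤ ((C₀ + (2 * N + 1) * K) * M.h ^ 2) ^ 2 := by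
  have h_proj := H.hasLipschitzDeriv (H.time_mem (time_zero τ ▸ H.time_pos.le))
  have err_le : ∀ j < M.m, ∀ y ∈ Icc (M.x j) (M.x (j + 1)), ∀ z ∈ Icc (M.x j) (M.x (j + 1)),
      √(z ^ (N - 1)) * |θ 0 y| ≤ (C₀ + (2 * N + 1) * K) * M.h ^ 2 := by
    intro j hj y hy z hz
    have hz01 := M.elem_subset hj hz
    have h_node := h_proj.sqrt_weight_mul_abs_proj_sub_le N hj hy hz
    simp only [time_zero] at h_node
    have h_start : √(z ^ (N - 1)) * |U 0 y - u (y, 0)| ≤ C₀ * M.h ^ 2 :=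
      (mul_le_of_le_one_left (abs_nonneg _)
        (Real.sqrt_le_one.2 (pow_le_one₀ hz01.1 hz01.2))).trans
          (h_init y (M.elem_subset hj hy))
    have h_tri := mul_le_mul_of_nonneg_left
      (abs_sub_le (U 0 y) (u (y, 0)) (M.proj N (fun z => dx u (z, 0)) y))
      (Real.sqrt_nonneg (z ^ (N - 1)))
    rw [abs_sub_comm (u (y, 0))] at h_tri
    rw [err, time_zero]
    linarith
  exact (H.err_memS 0).lump_self_le N fun j hj y hy =>
    ⟨err_le j hj _ (left_mem_Icc.2 (M.x_lt j hj).le) y hy,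
      err_le j hj _ (right_mem_Icc.2 (M.x_lt j hj).le) y hy⟩

lemma ip_load_sub_le (hf : Continuous f)
    (hL : LipschitzOnWith L f (Icc (-(2 * K + 1) : ℝ) (2 * K + 1))) (hh : M.h ≤ 1)
    (hn : time τ (n + 1) ≤ T) (h_small : maxNorm (Icc 0 1) (θ n) ≤ 1) :
    ip N (fun y => load f T u τ U n y - M.proj N (quot (dx u) (time τ n) (τ n)) y)
        (fun y => load f T u τ U n y - M.proj N (quot (dx u) (time τ n) (τ n)) y)
      ≤ 2 * L ^ 2 * ip N (θ n) (θ n)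
        + 2 * ((L + 1) * ((2 * N + 1) * K) * (M.h ^ 2 + τmax)) ^ 2 := by
  refine ip_self_le ((H.continuousOn_load hf hn).fun_sub (M.proj_memS N _).cont)
    (H.err_memS n).cont fun y hy => ?_
  obtain ⟨j, hj, hyj⟩ := M.exists_mem_elem hy
  set q := quot u (time τ n) (τ n) y
  set W := M.proj N (quot (dx u) (time τ n) (τ n)) y
  set r := M.proj N (fun z => dx u (z, time τ n)) y - u (y, time τ n)
  set s := √(y ^ (N - 1))
  have s_nonneg : 0 ≤ s := Real.sqrt_nonneg _
  have s_le : s ≤ 1 := Real.sqrt_le_one.2 (pow_le_one₀ hy.1 hy.2)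
  have r_le : s * |r| ≤ (2 * N + 1) * K * M.h ^ 2 :=
    (H.hasLipschitzDeriv (H.time_mem_of_succ hn)).sqrt_weight_mul_abs_proj_sub_le N hj hyj hyj
  have W_sub_le : s * |W - q| ≤ (2 * N + 1) * K * M.h ^ 2 :=
    (H.hasLipschitzDeriv_quot hn).sqrt_weight_mul_abs_proj_sub_le N hj hyj hyj
  have time_le : s * (K * τ n) ≤ (2 * N + 1) * K * τmax := by
    have hτ := H.incr_le n
    have hτ0 := H.incr_pos n
    calc s * (K * τ n) ≤ 1 * (K * τ n) := by gcongr
      _ ≤ (2 * N + 1) * (K * τmax) := by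
        gcongr
        linarith [(Nat.cast_nonneg N : (0 : ℝ) ≤ N)]
      _ = _ := by ring
  have h_tri := mul_le_mul_of_nonneg_left
    ((abs_sub_le (load f T u τ U n y) q W).trans
      (add_le_add_left (H.abs_load_sub_quot_le hL hh hn h_small hy) _)) s_nonneg
  rw [abs_sub_comm q] at h_tri
  calc s * |load f T u τ U n y - W|
      ≤ L * (s * |θ n y|) + L * (s * |r|) + (L + 1) * (s * (K * τ n)) + s * |W - q| := by
        linarith
    _ ≤ L * (s * |θ n y|) + L * ((2 * N + 1) * K * M.h ^ 2)
        + (L + 1) * ((2 * N + 1) * K * τmax) + (2 * N + 1) * K * M.h ^ 2 := by gcongr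
    _ = L * (s * |θ n y|) + (L + 1) * ((2 * N + 1) * K) * (M.h ^ 2 + τmax) := by ring

lemma lump_err_succ_le (hN : 1 ≤ N) (hf : Continuous f)
    (hL : LipschitzOnWith L f (Icc (-(2 * K + 1) : ℝ) (2 * K + 1))) (hh : M.h ≤ 1)
    (hτ : τmax ≤ 1 / 2) (hn : time τ (n + 1) ≤ T) (h_small : maxNorm (Icc 0 1) (θ n) ≤ 1) :
    M.lump N (θ (n + 1)) (θ (n + 1)) ≤ (1 + (2 + 4 * L ^ 2) * τ n) * M.lump N (θ n) (θ n)
      + τ n * (6 * ((L + 1) * ((2 * N + 1) * K) * (M.h ^ 2 + τmax)) ^ 2) := by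
  have hτ0 := H.incr_max_nonneg
  have hτn := H.incr_pos n
  have slope_le : ∀ j < M.m, |M.slope (M.proj N (quot (dx u) (time τ n) (τ n))) j| ≤ K := by
    intro j hj
    rw [M.slope_proj N _ hj]
    simpa using Mesh.abs_avg_sub_le N (c := 0)
      (H.hasLipschitzDeriv_quot hn).lipschitz.continuousOn hj fun z hz => by
        simpa using H.abs_quot_dx_le hn (M.elem_subset hj hz)
  have h_step := (H.implicitStep hN hf hn).lump_self_le hτn (H.err_memS (n + 1))
    (H.continuousOn_load hf hn) (M.proj_memS N _) slope_le
  have h_ip := H.ip_load_sub_le hf hL hh hn h_small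
  have h_lump := mul_le_mul_of_nonneg_left ((H.err_memS n).ip_self_le_lump N)
    (show 0 ≤ 2 * (L : ℝ) ^ 2 by positivity)
  have h_slope : (K : ℝ) ^ 2 * M.h ^ 4
      ≤ ((L + 1) * ((2 * N + 1) * K) * (M.h ^ 2 + τmax)) ^ 2 := by
    rw [show (K : ℝ) ^ 2 * M.h ^ 4 = (1 * (1 * K) * (M.h ^ 2 + 0)) ^ 2 by ring]
    gcongr <;> linarith [L.coe_nonneg, (Nat.cast_nonneg N : (0 : ℝ) ≤ N)]
  set S := (L + 1) * ((2 * N + 1) * K) * (M.h ^ 2 + τmax)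
  have h_nonneg := H.lump_err_nonneg n
  have h_nonneg' := H.lump_err_nonneg (n + 1)
  set a := M.lump N (θ n) (θ n)
  set a' := M.lump N (θ (n + 1)) (θ (n + 1))
  have h_factor : 0 ≤ 1 - 2 * τ n := by linarith [H.incr_le n]
  have h_energy : (1 - τ n) * a' ≤ a + τ n * (2 * L ^ 2 * a + 3 * S ^ 2) :=
    h_step.trans (add_le_add le_rfl (mul_le_mul_of_nonneg_left (by linarith) hτn.le))
  calc a' ≤ (1 + 2 * τ n) * ((1 - τ n) * a') := by
        linarith [mul_nonneg (mul_nonneg hτn.le h_nonneg') h_factor]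
    _ ≤ (1 + 2 * τ n) * (a + τ n * (2 * L ^ 2 * a + 3 * S ^ 2)) := by gcongr
    _ ≤ (1 + (2 + 4 * L ^ 2) * τ n) * a + τ n * (6 * S ^ 2) := by
        linarith [mul_nonneg (mul_nonneg hτn.le (show 0 ≤ 2 * L ^ 2 * a + 3 * S ^ 2 by positivity))
          h_factor]

lemma maxNorm_err_le_one (hN : 1 ≤ N) (hf : Continuous f)
    (hL : LipschitzOnWith L f (Icc (-(2 * K + 1) : ℝ) (2 * K + 1))) (hh : M.h ≤ 1)
    (hC₀ : 0 ≤ C₀) (h_init : ∀ y ∈ Icc (0 : ℝ) 1, |U 0 y - u (y, 0)| ≤ C₀ * M.h ^ 2)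
    (h_small : Real.exp (L * T) * ((C₀ + K) * M.h + T * ((L + 2) * K * (M.h + τmax))) ≤ 1)
    (hn : time τ n ≤ T) : maxNorm (Icc 0 1) (θ n) ≤ 1 := by
  have hτ0 := H.incr_max_nonneg
  have h_pos := M.h_pos
  exact (le_exp_mul_of_succ_le (a := fun n => maxNorm (Icc 0 1) (θ n)) H.incr_pos L.coe_nonneg
    (by positivity) (by positivity) (H.maxNorm_err_zero_le hC₀ hh h_init) (fun n hn h =>
      H.maxNorm_err_succ_le hN hf hL hh hn (h.trans h_small)) hn).trans h_small

lemma lump_err_le (hN : 1 ≤ N) (hf : Continuous f)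
    (hL : LipschitzOnWith L f (Icc (-(2 * K + 1) : ℝ) (2 * K + 1))) (hh : M.h ≤ 1)
    (hτ : τmax ≤ 1 / 2) (hC₀ : 0 ≤ C₀)
    (h_init : ∀ y ∈ Icc (0 : ℝ) 1, |U 0 y - u (y, 0)| ≤ C₀ * M.h ^ 2)
    (h_small : ∀ n, time τ n ≤ T → maxNorm (Icc 0 1) (θ n) ≤ 1) (hn : time τ n ≤ T) :
    M.lump N (θ n) (θ n) ≤ Real.exp ((2 + 4 * L ^ 2) * T)
      * ((C₀ + (2 * N + 1) * K) ^ 2 + T * (6 * ((L + 1) * ((2 * N + 1) * K)) ^ 2))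
        * (M.h ^ 2 + τmax) ^ 2 := by
  have hτ0 := H.incr_max_nonneg
  have h_zero : M.lump N (θ 0) (θ 0) ≤ ((C₀ + (2 * N + 1) * K) * (M.h ^ 2 + τmax)) ^ 2 :=
    (H.lump_err_zero_le h_init).trans (by gcongr; linarith)
  refine (le_exp_mul_of_succ_le (a := fun n => M.lump N (θ n) (θ n)) H.incr_pos (by positivity)
    (by positivity) (by positivity) h_zero (fun n hn _ =>
      H.lump_err_succ_le hN hf hL hh hτ hn (h_small n (H.time_mem_of_succ hn).2)) hn).trans_eq ?_
  ring

lemma ip_sub_le (hn : time τ n ≤ T) :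
    ip N (fun y => U n y - u (y, time τ n)) (fun y => U n y - u (y, time τ n))
      ≤ 2 * M.lump N (θ n) (θ n) + 2 * ((2 * N + 1) * K * M.h ^ 2) ^ 2 := by
  have h_le := ip_self_le (N := N) (a := 1) (B := (2 * N + 1) * K * M.h ^ 2)
    ((H.scheme.mem n).cont.fun_sub (continuousOn_slice H.smooth.cont (H.time_mem hn)))
    (H.err_memS n).cont fun y hy => by
      obtain ⟨j, hj, hyj⟩ := M.exists_mem_elem hy
      have h_proj :=
        (H.hasLipschitzDeriv (H.time_mem hn)).sqrt_weight_mul_abs_proj_sub_le N hj hyj hyj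
      have h_tri := mul_le_mul_of_nonneg_left
        (abs_sub_le (U n y) (M.proj N (fun z => dx u (z, time τ n)) y) (u (y, time τ n)))
        (Real.sqrt_nonneg (y ^ (N - 1)))
      rw [← err] at h_tri
      linarith
  linarith [(H.err_memS n).ip_self_le_lump N]

lemma wnorm_sub_le (hN : 1 ≤ N) (hf : Continuous f)
    (hL : LipschitzOnWith L f (Icc (-(2 * K + 1) : ℝ) (2 * K + 1))) (hh : M.h ≤ 1)
    (hτ : τmax ≤ 1 / 2) (hC₀ : 0 ≤ C₀)
    (h_init : ∀ y ∈ Icc (0 : ℝ) 1, |U 0 y - u (y, 0)| ≤ C₀ * M.h ^ 2)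
    (h_small : Real.exp (L * T) * ((C₀ + K) * M.h + T * ((L + 2) * K * (M.h + τmax))) ≤ 1)
    (hn : time τ n ≤ T) :
    wnorm N (fun y => U n y - u (y, time τ n)) ≤ errorConst N T C₀ K L * (M.h ^ 2 + τmax) := by
  have hτ0 := H.incr_max_nonneg
  have h_lump := H.lump_err_le hN hf hL hh hτ hC₀ h_init
    (fun _ hn => H.maxNorm_err_le_one hN hf hL hh hC₀ h_init h_small hn) hn
  have h_proj : ((2 * N + 1) * K * M.h ^ 2) ^ 2
      ≤ ((2 * N + 1) * K : ℝ) ^ 2 * (M.h ^ 2 + τmax) ^ 2 := by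
    rw [← mul_pow]
    gcongr
    linarith
  rw [wnorm, errorConst, ← Real.sqrt_sq (show 0 ≤ M.h ^ 2 + τmax by positivity),
    ← Real.sqrt_mul' _ (sq_nonneg _)]
  exact Real.sqrt_le_sqrt (by linarith [H.ip_sub_le hn])

end IsApproximation

end RadialHeat

open RadialHeat

theorem theorem2p4_general (N : ℕ) (hN : 1 ≤ N) (f : ℝ → ℝ) (hf : LocallyLipschitz f)
    (T : ℝ) (hT : 0 < T) (K : ℝ) (C₀ : ℝ) (hC₀ : 0 < C₀) :
    ∃ C > 0, ∃ h₀ > 0, ∃ τ₀ > 0,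
      ∀ (u0 : ℝ → ℝ) (u : ℝ × ℝ → ℝ),
        ContinuousOn u0 (Set.Icc 0 1) → IsSolution N f u0 T u → IsSmooth T u → kappa T u ≤ K →
      ∀ (M : Mesh) (τ : ℕ → ℝ) (τmax : ℝ) (U : ℕ → ℝ → ℝ),
        (∀ j, 0 < τ j) → IsLUB (Set.range τ) τmax → M.h ≤ h₀ → τmax ≤ τ₀ → IsML1 N f M τ U →
        maxNorm (Set.Icc 0 1) (fun x => U 0 x - u0 x) ≤ C₀ * M.h ^ 2 →
        ∀ n, time τ n ≤ T →
          wnorm N (fun x => U n x - u (x, time τ n)) ≤ C * (M.h ^ 2 + τmax) := by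
  obtain ⟨L, hL⟩ := (hf.locallyLipschitzOn
    (s := Icc (-(2 * K.toNNReal + 1) : ℝ) (2 * K.toNNReal + 1))
      ).exists_lipschitzOnWith_of_compact isCompact_Icc
  set Q := Real.exp (L * T) * (C₀ + K.toNNReal + T * ((L + 2) * K.toNNReal)) with hQ
  have hQ0 : 0 < Q := by positivity
  refine ⟨errorConst N T C₀ K.toNNReal L, errorConst_pos hT.le hC₀, min 1 (1 / (2 * Q)),
    by positivity, min (1 / 2) (1 / (2 * Q)), by positivity, ?_⟩
  intro u0 u hu0 hs hu hK M τ τmax U hτ h_lub hh hτ₀ hU h_init n hn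
  have H : IsApproximation N f u0 T K.toNNReal u M τ τmax U :=
    ⟨hT, hs, hu.isSmoothBy (hK.trans K.le_coe_toNNReal), hU, hτ, fun j => h_lub.1 ⟨j, rfl⟩⟩
  rw [le_min_iff] at hh hτ₀
  have h_init' : ∀ y ∈ Icc (0 : ℝ) 1, |U 0 y - u (y, 0)| ≤ C₀ * M.h ^ 2 := fun y hy => by
    rw [hs.initial_Icc hu hT hu0 hy]
    exact (abs_le_maxNorm isCompact_Icc ((hU.mem 0).cont.fun_sub hu0) hy).trans h_init
  have h_small : Real.exp (L * T) * ((C₀ + K.toNNReal) * M.h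
      + T * ((L + 2) * K.toNNReal * (M.h + τmax))) ≤ 1 :=
    calc _ ≤ Real.exp (L * T) * ((C₀ + K.toNNReal) * (M.h + τmax)
            + T * ((L + 2) * K.toNNReal * (M.h + τmax))) := by
          gcongr
          linarith [H.incr_max_nonneg]
      _ = Q * (M.h + τmax) := by rw [hQ]; ring
      _ ≤ Q * (1 / (2 * Q) + 1 / (2 * Q)) := by gcongr <;> linarith
      _ = 1 := by field_simp; norm_num
  exact H.wnorm_sub_le hN hf.continuous hL hh.1 hτ₀.1 hC₀.le h_init' h_small hn

theorem theorem2p4 (N : ℕ) (hN : 2 ≤ N) (f : ℝ → ℝ) (hf : LocallyLipschitz f)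
    (T : ℝ) (hT : 0 < T) (K : ℝ) (C₀ : ℝ) (hC₀ : 0 < C₀) (β : ℝ) (hβ : 0 < β) :
    ∃ C > 0, ∃ h₀ > 0, ∃ τ₀ > 0,
      ∀ (u0 : ℝ → ℝ) (u : ℝ × ℝ → ℝ),
        ContinuousOn u0 (Set.Icc 0 1) →
        RadialHeat.IsSolution N f u0 T u →
        RadialHeat.IsSmooth T u →
        RadialHeat.kappa T u ≤ K →
      ∀ (M : RadialHeat.Mesh) (τ : ℕ → ℝ) (τmax : ℝ) (U : ℕ → ℝ → ℝ),
        M.QuasiUniform β →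
        (∀ j, 0 < τ j) →
        IsLUB (Set.range τ) τmax →
        M.h ≤ h₀ →
        τmax ≤ τ₀ →
        RadialHeat.IsML1 N f M τ U →
        RadialHeat.maxNorm (Set.Icc 0 1) (fun x => U 0 x - u0 x) ≤ C₀ * M.h ^ 2 →
        ∀ n, RadialHeat.time τ n ≤ T →
          RadialHeat.wnorm N (fun x => U n x - u (x, RadialHeat.time τ n))
            ≤ C * (M.h ^ 2 + τmax) := by
  obtain ⟨C, hC, h₀, hh₀, τ₀, hτ₀, h⟩ :=
    theorem2p4_general N (one_le_two.trans hN) f hf T hT K C₀ hC₀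
  exact ⟨C, hC, h₀, hh₀, τ₀, hτ₀, fun u0 u hu0 hs hu hK M τ τmax U _ =>
    h u0 u hu0 hs hu hK M τ τmax U⟩
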